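/- For $r\ge 1$ let $f_r=\prod_{m\ge1}(1-q^{rm})$, and for $\ell\ge1$ let $b_\ell(n)$ be the number of partitions of $n$ none of whose parts is divisible by $\ell$. Define an integer matrix $(m_{i,j})_{i,j\ge1}$ as follows. Its first seven rows are (with all entries not listed equal to $0$) - $m_{1,\cdot}=(7,\;7^2)$, - $m_{2,\cdot}=(10,\;9\cdot7^2,\;2\cdot7^4,\;7^5)$, - $m_{3,\cdot}=(3,\;114\cdot7,\;85\cdot7^3,\;24\cdot7^5,\;3\cdot7^7,\;7^8)$, - $m_{4,\cdot}=(0,\;82\cdot7,\;176\cdot7^3,\;845\cdot7^4,\;272\cdot7^6,\;46\cdot7^8,\;4\cdot7^{10},\;7^{11})$, - $m_{5,\cdot}=(0,\;190,\;1265\cdot7^2,\;1895\cdot7^4,\;1233\cdot7^6,\;3025\cdot7^7,\;620\cdot7^9,\;75\cdot7^{11},\;5\cdot7^{13},\;7^{14})$, - $m_{6,\cdot}=(0,\;27,\;736\cdot7^2,\;16782\cdot7^3,\;20424\cdot7^5,\;12825\cdot7^7,\;4770\cdot7^9,\;7830\cdot7^{10},\;1178\cdot7^{12},\;111\cdot7^{14},\;6\cdot7^{16},\;7^{17})$,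 - $m_{7,\cdot}=(0,\;1,\;253\cdot7^2,\;1902\cdot7^4,\;4246\cdot7^6,\;31540\cdot7^7,\;19302\cdot7^9,\;7501\cdot7^{11},\;1944\cdot7^{13},\;2397\cdot7^{14},\;285\cdot7^{16},\;22\cdot7^{18},\;7^{20},\;7^{20})$; moreover $m_{i,1}=m_{i,2}=0$ for $i\ge8$, and for $i\ge8$, $j\ge3$, $$\begin{aligned}m_{i,j}={}&7m_{i-3,j-1}+35m_{i-2,j-1}+49m_{i-1,j-1}+m_{i-7,j-2}+7m_{i-6,j-2}\\&+21m_{i-5,j-2}+49m_{i-4,j-2}+147m_{i-3,j-2}+343m_{i-2,j-2}+343m_{i-1,j-2}.\end{aligned}$$ Define integers $x_{k,i}$ ($k,i\ge1$) by $(x_{1,1},x_{1,2},\dots)=(7,7^2,0,0,\dots)$ and, for $k\ge1$, $$x_{k+1,i}=\begin{cases}\sum_{j\ge1}x_{k,j}\,m_{4j,\,j+i}&\text{if }k\text{ is odd},\\ \sum_{j\ge1}x_{k,j}\,m_{4j+1,\,j+i}&\text{if }k\text{ is even}.\end{cases}$$ For $k\ge1$ define $y^{(2k-1)}_{\beta,j}$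 ($\beta,j\ge1$) by $y^{(2k-1)}_{1,j}=x_{2k-1,j}$ and, for $\beta\ge1$, $$y^{(2k-1)}_{\beta+1,j}=\begin{cases}\sum_{i\ge1}y^{(2k-1)}_{\beta,i}\,m_{4i-1,\,i+j-1}&\text{if }\beta\text{ is odd},\\ \sum_{i\ge1}y^{(2k-1)}_{\beta,i}\,m_{4i-3,\,i+j-1}&\text{if }\beta\text{ is even}.\end{cases}$$ All these sums have only finitely many nonzero terms. Then for every $\beta\ge0$ and $k\ge1$, as identities of formal power series in $q$, $$\sum_{n\ge0}b_{7^{2k-1}}\!\left(7^{2k+2\beta-1}n+\frac{18\cdot7^{2k+2\beta-1}-7^{2k-1}+1}{24}\right)q^n=\sum_{j\ge1}y^{(2k-1)}_{2\beta+1,j}\,q^{j-1}\left(\frac{f_7}{f_1}\right)^{4j-1}$$ and $$\sum_{n\ge0}b_{7^{2k-1}}\!\left(7^{2k+2\beta}n+\frac{6\cdot7^{2k+2\beta}-7^{2k-1}+1}{24}\right)q^n=\sum_{j\ge1}y^{(2k-1)}_{2\beta+2,j}\,q^{j-1}\left(\frac{f_7}{f_1}\right)^{4j-3}.$$ -/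

import Mathlib

open scoped PowerSeries PowerSeries.WithPiTopology

namespace SevenRegular

/-- `f r = ∏_{m ≥ 1} (1 - q ^ (r m))` as a formal power series in `q = X` over `ℤ`; the infinite
product is taken coefficientwise (`ℤ` is discrete), see `multipliable_f`. -/
noncomputable def f (r : ℕ) : ℤ⟦X⟧ := ∏' m : ℕ, (1 - PowerSeries.X ^ (r * (m + 1)))

/-- For `r ≥ 1` the product defining `f r` converges. -/
theorem multipliable_f {r : ℕ} (hr : 1 ≤ r) :
    Multipliable fun m : ℕ => (1 - PowerSeries.X ^ (r * (m + 1)) : ℤ⟦X⟧) := by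
  have h : Filter.Tendsto (fun m : ℕ => (-(PowerSeries.X : ℤ⟦X⟧) ^ (r * (m + 1))).order)
      Filter.atTop (nhds ⊤) := by
    simp_rw [PowerSeries.order_neg, PowerSeries.order_X_pow]
    refine ENat.tendsto_natCast_nhds_top.comp ?_
    exact Filter.tendsto_atTop_mono (fun n => by nlinarith) (Filter.tendsto_add_atTop_nat 1)
  simpa [sub_eq_add_neg] using
    PowerSeries.WithPiTopology.multipliable_one_add_of_tendsto_order_atTop_nhds_top ℤ h

theorem constantCoeff_f {r : ℕ} (hr : 1 ≤ r) : PowerSeries.constantCoeff (f r) = 1 := by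
  have h := (multipliable_f hr).map_tprod (PowerSeries.constantCoeff (R := ℤ))
    (PowerSeries.WithPiTopology.continuous_constantCoeff ℤ)
  have hr' : r ≠ 0 := by omega
  rw [f, h]
  simp [hr']

/-- The quotient `f_7 / f_1` in `ℤ⟦q⟧` (`f_1` has constant coefficient `1`, so it is invertible),
see `f_one_mul_quot`. -/
noncomputable def quot : ℤ⟦X⟧ := f 7 * PowerSeries.invOfUnit (f 1) 1

theorem f_one_mul_quot : f 1 * quot = f 7 := by
  have h := PowerSeries.mul_invOfUnit (f 1) 1 (by simpa using constantCoeff_f le_rfl)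
  rw [quot, mul_left_comm, h, mul_one]

/-- `b ℓ n` is the number of `ℓ`-regular partitions of `n`, i.e. of the partitions of `n` none of
whose parts is divisible by `ℓ`. -/
def b (ℓ n : ℕ) : ℕ := (Nat.Partition.restricted n (fun i => ¬ ℓ ∣ i)).card

/-- The first seven rows of the matrix `M = (m_{i,j})_{i,j ≥ 1}`; the row `i` is the `i`-th list,
its entry for `j` is the `j`-th member of the list, and all entries beyond the list are `0`. -/
def mRows : List (List ℤ) :=
  [[7, 7 ^ 2],
   [10, 9 * 7 ^ 2, 2 * 7 ^ 4, 7 ^ 5],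
   [3, 114 * 7, 85 * 7 ^ 3, 24 * 7 ^ 5, 3 * 7 ^ 7, 7 ^ 8],
   [0, 82 * 7, 176 * 7 ^ 3, 845 * 7 ^ 4, 272 * 7 ^ 6, 46 * 7 ^ 8, 4 * 7 ^ 10, 7 ^ 11],
   [0, 190, 1265 * 7 ^ 2, 1895 * 7 ^ 4, 1233 * 7 ^ 6, 3025 * 7 ^ 7, 620 * 7 ^ 9,
    75 * 7 ^ 11, 5 * 7 ^ 13, 7 ^ 14],
   [0, 27, 736 * 7 ^ 2, 16782 * 7 ^ 3, 20424 * 7 ^ 5, 12825 * 7 ^ 7, 4770 * 7 ^ 9,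
    7830 * 7 ^ 10, 1178 * 7 ^ 12, 111 * 7 ^ 14, 6 * 7 ^ 16, 7 ^ 17],
   [0, 1, 253 * 7 ^ 2, 1902 * 7 ^ 4, 4246 * 7 ^ 6, 31540 * 7 ^ 7, 19302 * 7 ^ 9,
    7501 * 7 ^ 11, 1944 * 7 ^ 13, 2397 * 7 ^ 14, 285 * 7 ^ 16, 22 * 7 ^ 18, 7 ^ 20, 7 ^ 20]]

/-- The matrix `(m_{i,j})`, `i, j ≥ 1` (the values at `i = 0` or `j = 0` are dummies): the first
seven rows are given by the table; `m_{i,1} = m_{i,2} = 0` for `i ≥ 8`; and for `i ≥ 8`, `j ≥ 3`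
there is a linear recurrence (written with `i = n + 8`, `j = l + 3`). -/
def m : ℕ → ℕ → ℤ
  | 0, _ => 0
  | n + 8, j =>
    match j with
    | 0 => 0
    | 1 => 0
    | 2 => 0
    | l + 3 =>
      7 * m (n + 5) (l + 2) + 35 * m (n + 6) (l + 2) + 49 * m (n + 7) (l + 2)
        + m (n + 1) (l + 1) + 7 * m (n + 2) (l + 1) + 21 * m (n + 3) (l + 1)
        + 49 * m (n + 4) (l + 1) + 147 * m (n + 5) (l + 1) + 343 * m (n + 6) (l + 1)
        + 343 * m (n + 7) (l + 1)
  | i + 1, j =>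
    match j with
    | 0 => 0
    | j + 1 => (mRows.getD i []).getD j 0

/-- `m_{i,j} = 0` if `7 j < 2 i`; hence all sums below are finite. -/
theorem m_eq_zero (i j : ℕ) (h : 7 * j < 2 * i) : m i j = 0 := by
  induction i using Nat.strong_induction_on generalizing j with
  | _ i ih =>
    rcases lt_or_ge i 8 with hi | hi
    · have hj : j < 2 := by omega
      interval_cases i <;> interval_cases j <;> first | omega | simp [m, mRows]
    · obtain ⟨n, rfl⟩ := Nat.exists_eq_add_of_le' hi
      match j, h with
      | 0, _ => simp [m]
      | 1, _ => simp [m]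
      | 2, _ => simp [m]
      | l + 3, h =>
        rw [m]
        rw [ih (n + 5) (by omega) (l + 2) (by omega), ih (n + 6) (by omega) (l + 2) (by omega),
          ih (n + 7) (by omega) (l + 2) (by omega), ih (n + 1) (by omega) (l + 1) (by omega),
          ih (n + 2) (by omega) (l + 1) (by omega), ih (n + 3) (by omega) (l + 1) (by omega),
          ih (n + 4) (by omega) (l + 1) (by omega), ih (n + 5) (by omega) (l + 1) (by omega),
          ih (n + 6) (by omega) (l + 1) (by omega), ih (n + 7) (by omega) (l + 1) (by omega)]
        simp

/-- The coefficient vectors `x_k = (x_{k,1}, x_{k,2}, …)`, `k ≥ 1` (`k = 0` is a dummy):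
`x_1 = (7, 7 ^ 2, 0, …)`, and `x_{k+1,i} = ∑_{j ≥ 1} x_{k,j} m_{4j,j+i}` for odd `k`,
`x_{k+1,i} = ∑_{j ≥ 1} x_{k,j} m_{4j+1,j+i}` for even `k`. The sums are finite,
see `finite_sums`. -/
noncomputable def x : ℕ → ℕ → ℤ
  | 0 => fun _ => 0
  | 1 => fun i => if i = 1 then 7 else if i = 2 then 7 ^ 2 else 0
  | k + 2 => fun i =>
    if Odd (k + 1) then ∑ᶠ (j : ℕ) (_ : 1 ≤ j), x (k + 1) j * m (4 * j) (j + i)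
    else ∑ᶠ (j : ℕ) (_ : 1 ≤ j), x (k + 1) j * m (4 * j + 1) (j + i)

/-- The coefficients `y k β j = y^{(2k-1)}_{β,j}`, `k, β, j ≥ 1` (`β = 0` is a dummy):
`y^{(2k-1)}_{1,j} = x_{2k-1,j}`, and
`y^{(2k-1)}_{β+1,j} = ∑_{i ≥ 1} y^{(2k-1)}_{β,i} m_{4i-1,i+j-1}` for odd `β`,
`y^{(2k-1)}_{β+1,j} = ∑_{i ≥ 1} y^{(2k-1)}_{β,i} m_{4i-3,i+j-1}` for even `β`. The sums are finite,
see `finite_sums`. -/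
noncomputable def y (k : ℕ) : ℕ → ℕ → ℤ
  | 0 => fun _ => 0
  | 1 => fun j => x (2 * k - 1) j
  | β + 2 => fun j =>
    if Odd (β + 1) then
      ∑ᶠ (i : ℕ) (_ : 1 ≤ i), y k (β + 1) i * m (4 * i - 1) (i + j - 1)
    else ∑ᶠ (i : ℕ) (_ : 1 ≤ i), y k (β + 1) i * m (4 * i - 3) (i + j - 1)

/-- The four kinds of sums in the definitions of `x` and `y` have finitely many nonzero terms. -/
theorem finite_sums (v : ℕ → ℤ) (j : ℕ) :
    {i | 1 ≤ i ∧ v i * m (4 * i) (i + j) ≠ 0}.Finite ∧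
    {i | 1 ≤ i ∧ v i * m (4 * i + 1) (i + j) ≠ 0}.Finite ∧
    {i | 1 ≤ i ∧ v i * m (4 * i - 1) (i + j - 1) ≠ 0}.Finite ∧
    {i | 1 ≤ i ∧ v i * m (4 * i - 3) (i + j - 1) ≠ 0}.Finite := by
  refine ⟨?_, ?_, ?_, ?_⟩ <;>
  · refine (Set.finite_le_nat (7 * j + 7)).subset fun i hi => ?_
    obtain ⟨h1, h2⟩ := hi
    show i ≤ 7 * j + 7
    by_contra hlt
    exact h2 (by rw [m_eq_zero _ _ (by omega), mul_zero])

end SevenRegular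

namespace SevenRegular

open Finset PowerSeries

/-! Write t = q (f_7/f_1)^4 (`hauptmodul`) and Z = q^2 f_49/f_1 (`ratio`), and let U (`huff`) keep
the coefficients at multiples of 7. Everything rests on a degree-seven equation for Z whose
coefficients are polynomials in t(q^7), `ratio_pow_seven`. Its roots are the seven conjugates Z(ζ^k
q), so Newton's identities give U(Z^i) for i ≤ 7. The results are the seven tabulated rows, and
multiplying the equation by powers of Z gives the recurrence defining the remaining rows: U(Z^i) =
Σ_j m_{i,j} t^j (`huff_ratio_pow`).

The equation is obtained from power series alone. Pentagonal numbers occupy only the classes 0, 1,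
2, 5 modulo 7, and class 2 contributes exactly -E with E = q^2 f_49, so f_1 = A + B + D - E. By
Jacobi's formula for f_1^3 the classes 2, 4, 5 of the cube vanish and class 6 is -7E^3, which yields
four cubic relations between A, B, D, E. These imply an equation of degree 7 for f_1 over E and a
quartic form V (`sq_eq_of_relations`). Comparing its constant term with the product of the
conjugates of f_1 gives V^2 = (q f_7^4)^2, and the coefficient of q fixes the sign.

For the partition functions, Z = q^2 (f_7/f_1)(f_49/f_7) turns U(Z^k) into U(q^r (f_7/f_1)^k)
whenever 2k = 7s + r. Extracting a progression modulo 7 therefore acts on the coefficient vectors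
through entries of m. Starting from f_ℓ/f_1 with ℓ = 7^(2k-1), the first 2k-1 extractions use up the
numerator and produce the vectors x (`mk_b_eq_x`). After that only powers of f_7/f_1 remain, and
further extractions produce the vectors y (`mk_b_eq_y`). -/

/-! ### Jacobi's identity for the cube of the Euler product, from a finite form. -/

/-- The finite product `∏_{i = 1}^n (1 - X ^ i)`. -/
noncomputable def eulerProd (n : ℕ) : ℤ⟦X⟧ := ∏ i ∈ range n, (1 - X ^ (i + 1))

theorem eulerProd_zero : eulerProd 0 = 1 := by simp [eulerProd]

theorem eulerProd_succ (n : ℕ) : eulerProd (n + 1) = eulerProd n * (1 - X ^ (n + 1)) :=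
  prod_range_succ _ _

/-- The inverse of `eulerProd n`. -/
noncomputable def eulerInv (n : ℕ) : ℤ⟦X⟧ := invOfUnit (eulerProd n) 1

theorem eulerProd_mul_eulerInv (n : ℕ) : eulerProd n * eulerInv n = 1 :=
  mul_invOfUnit _ _ (by simp [eulerProd, map_prod])

theorem eulerInv_eq_succ (n : ℕ) : eulerInv n = (1 - X ^ (n + 1)) * eulerInv (n + 1) := by
  have h1 := eulerProd_mul_eulerInv n
  have h2 := eulerProd_mul_eulerInv (n + 1)
  rw [eulerProd_succ] at h2
  linear_combination (-eulerInv n) * h2 + ((1 - X ^ (n + 1)) * eulerInv (n + 1)) * h1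

/-- `1 / eulerProd (n - 1)`, with value `0` at `n = 0`. -/
noncomputable def eulerInvPred : ℕ → ℤ⟦X⟧
  | 0 => 0
  | n + 1 => eulerInv n

/-- The value 0 at n = 0 fits because the factor 1 - X^0 vanishes. Hence the recurrences below need
no exception where a term of index beyond n appears. -/
theorem eulerInvPred_eq_succ (n : ℕ) :
    eulerInvPred n = (1 - X ^ n) * eulerInvPred (n + 1) := by
  cases n with
  | zero => simp [eulerInvPred]
  | succ n => exact eulerInv_eq_succ n

/-- The signed power `(-1) ^ k X ^ (k (k + 1) / 2)`. -/
noncomputable def signedTriangular (k : ℕ) : ℤ⟦X⟧ := (-1) ^ k * X ^ (k * (k + 1) / 2)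

theorem signedTriangular_succ (k : ℕ) :
    signedTriangular (k + 1) = -(X ^ (k + 1) * signedTriangular k) := by
  have h : (k + 1) * (k + 1 + 1) / 2 = k * (k + 1) / 2 + (k + 1) := by
    rw [show (k + 1) * (k + 1 + 1) = k * (k + 1) + 2 * (k + 1) by ring,
      Nat.add_mul_div_left _ _ two_pos]
  rw [signedTriangular, signedTriangular, h]
  ring

/-- The coefficients of the finite form of the Jacobi triple product. -/
noncomputable def finiteJacobi (n k : ℕ) : ℤ⟦X⟧ :=
  signedTriangular k * eulerProd (2 * n + 1) * eulerInvPred (n + 1 - k) * eulerInv (n + k + 1)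

theorem finiteJacobi_eq_zero {n k : ℕ} (h : n < k) : finiteJacobi n k = 0 := by
  simp [finiteJacobi, Nat.sub_eq_zero_of_le (Nat.succ_le_of_lt h), eulerInvPred]

theorem eulerProd_two_mul_add_three (n : ℕ) : eulerProd (2 * (n + 1) + 1) =
    eulerProd (2 * n + 1) * (1 - X ^ (2 * n + 2)) * (1 - X ^ (2 * n + 3)) := by
  rw [show 2 * (n + 1) + 1 = 2 * n + 1 + 1 + 1 by ring, eulerProd_succ, eulerProd_succ]

/-- This and the next lemma are multiplication by (1 - z X^(n+1))(1 - z⁻¹ X^(n+1)), read off on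
coefficients of powers of z. The extra last term here is the coefficient of index -1, which by
antisymmetry under k ↦ -1 - k is minus that of index 0. -/
theorem finiteJacobi_succ_zero (n : ℕ) : finiteJacobi (n + 1) 0 =
    -X ^ (n + 1) * finiteJacobi n 1 + (1 + X ^ (2 * n + 2)) * finiteJacobi n 0
      + X ^ (n + 1) * finiteJacobi n 0 := by
  simp only [finiteJacobi, signedTriangular_succ, eulerProd_two_mul_add_three, Nat.sub_zero,
    Nat.add_sub_cancel, add_zero]
  rw [eulerInvPred_eq_succ n, eulerInvPred_eq_succ (n + 1), eulerInv_eq_succ (n + 1)]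
  ring

theorem finiteJacobi_succ_succ {n k : ℕ} (h : k ≤ n) : finiteJacobi (n + 1) (k + 1) =
    -X ^ (n + 1) * finiteJacobi n (k + 2) + (1 + X ^ (2 * n + 2)) * finiteJacobi n (k + 1)
      - X ^ (n + 1) * finiteJacobi n k := by
  rcases h.eq_or_lt with rfl | h
  · rw [finiteJacobi_eq_zero (show k < k + 2 by omega),
      finiteJacobi_eq_zero (show k < k + 1 by omega)]
    have h1 := eulerProd_mul_eulerInv (2 * k + 1)
    have h2 := eulerProd_mul_eulerInv (2 * (k + 1) + 1)
    simp only [finiteJacobi, signedTriangular_succ, show k + 1 + 1 - (k + 1) = 1 by omega,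
      show k + 1 - k = 1 by omega, show k + 1 + (k + 1) + 1 = 2 * (k + 1) + 1 by ring,
      show k + k + 1 = 2 * k + 1 by ring]
    linear_combination (X ^ (k + 1) * signedTriangular k * eulerInvPred 1) * (h1 - h2)
  · obtain ⟨d, rfl⟩ := Nat.exists_eq_add_of_lt h
    simp only [finiteJacobi, signedTriangular_succ, eulerProd_two_mul_add_three,
      show k + d + 1 + 1 + 1 - (k + 1) = d + 2 by omega,
      show k + d + 1 + 1 - (k + 2) = d by omega, show k + d + 1 + 1 - (k + 1) = d + 1 by omega,
      show k + d + 1 + 1 - k = d + 2 by omega,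
      show k + d + 1 + 1 + (k + 1) + 1 = 2 * k + d + 4 by ring,
      show k + d + 1 + (k + 2) + 1 = 2 * k + d + 4 by ring,
      show k + d + 1 + (k + 1) + 1 = 2 * k + d + 3 by ring,
      show k + d + 1 + k + 1 = 2 * k + d + 2 by ring]
    rw [eulerInvPred_eq_succ d, eulerInvPred_eq_succ (d + 1), eulerInv_eq_succ (2 * k + d + 2),
      eulerInv_eq_succ (2 * k + d + 3)]
    ring

/-- The weights 2k+1 are linear in k, so the sum of the two neighbouring weights is twice the middle
one. The three-term operator therefore acts on the weighted sum as the scalar d - 2c, up to boundary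
terms. -/
theorem sum_odd_mul_of_recurrence {R : Type*} [CommRing R] (β γ : ℕ → R) (c d : R) (n : ℕ)
    (h0 : γ 0 = -c * β 1 + d * β 0 + c * β 0)
    (h : ∀ k < n, γ (k + 1) = -c * β (k + 2) + d * β (k + 1) - c * β k) :
    ∑ k ∈ range (n + 1), (2 * k + 1 : R) * γ k =
      (d - 2 * c) * ∑ k ∈ range (n + 1), (2 * k + 1 : R) * β k
        - c * (2 * n + 1) * β (n + 1) + c * (2 * n + 3) * β n := by
  induction n with
  | zero => simp [h0]; ring
  | succ n ih =>
    rw [sum_range_succ, sum_range_succ _ (n + 1), ih fun k hk => h k (by omega), h n (by omega)]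
    push_cast
    ring

/-- Here the scalar d - 2c equals (1 - X^(n+1))^2, exactly the growth factor of the right-hand side.
-/
theorem sum_finiteJacobi (n : ℕ) :
    ∑ k ∈ range (n + 1), (2 * k + 1 : ℤ⟦X⟧) * finiteJacobi n k = eulerProd n ^ 2 := by
  induction n with
  | zero =>
    have h := eulerProd_mul_eulerInv 1
    have h0 := eulerProd_mul_eulerInv 0
    rw [eulerProd_zero, one_mul] at h0
    simp [finiteJacobi, signedTriangular, eulerInvPred, h0, h, eulerProd_zero]
  | succ n ih =>
    rw [sum_odd_mul_of_recurrence (finiteJacobi n) (finiteJacobi (n + 1)) (X ^ (n + 1))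
      (1 + X ^ (2 * n + 2)) (n + 1) (finiteJacobi_succ_zero n)
      fun k hk => finiteJacobi_succ_succ (by omega), sum_range_succ, ih,
      finiteJacobi_eq_zero (show n < n + 1 by omega),
      finiteJacobi_eq_zero (show n < n + 1 + 1 by omega), eulerProd_succ]
    ring

theorem X_pow_dvd_eulerProd_sub {N n : ℕ} (h : N ≤ n) :
    (X : ℤ⟦X⟧) ^ N ∣ eulerProd n - eulerProd N := by
  induction n, h using Nat.le_induction with
  | base => simp
  | succ n hn ih =>
    rw [eulerProd_succ, show eulerProd n * (1 - X ^ (n + 1)) - eulerProd N =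
      eulerProd n - eulerProd N - X ^ (n + 1) * eulerProd n by ring]
    exact dvd_sub ih (Dvd.dvd.mul_right (pow_dvd_pow _ (by omega)) _)

theorem hasProd_f {r : ℕ} (hr : 1 ≤ r) :
    HasProd (fun m : ℕ => (1 - X ^ (r * (m + 1)) : ℤ⟦X⟧)) (f r) :=
  (multipliable_f hr).hasProd

theorem X_pow_dvd_f_one_sub (N : ℕ) : (X : ℤ⟦X⟧) ^ N ∣ f 1 - eulerProd N := by
  rw [X_pow_dvd_iff]
  intro i hi
  have h := (hasProd_f le_rfl).tendsto_prod_nat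
  simp only [one_mul] at h
  rw [PowerSeries.WithPiTopology.tendsto_iff_coeff_tendsto] at h
  have h := tendsto_nhds_unique (h i) (tendsto_const_nhds.congr' ?_) (b := coeff i (eulerProd N))
  · rw [map_sub, h, sub_self]
  · filter_upwards [Filter.eventually_ge_atTop N] with n hn
    have := X_pow_dvd_iff.mp (X_pow_dvd_eulerProd_sub hn) i hi
    rw [map_sub, sub_eq_zero] at this
    exact this.symm

/-- Jacobi's identity for the cube of the Euler product, up to order `N`. -/
theorem X_pow_dvd_f_one_pow_three_sub (N : ℕ) :
    (X : ℤ⟦X⟧) ^ N ∣ f 1 ^ 3 - ∑ k ∈ range N, (2 * k + 1 : ℤ⟦X⟧) * signedTriangular k := by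
  -- Modulo X^N every Euler product of length at least N equals f 1. At level 2N each coefficient
  -- with k < N has both denominators long enough to become Jacobi's term divided by f 1, and those
  -- with k ≥ N vanish.
  set π := Ideal.Quotient.mk (Ideal.span {(X : ℤ⟦X⟧) ^ N}) with hπ
  have hdvd : ∀ a b, π a = π b ↔ X ^ N ∣ a - b := fun a b => by
    rw [hπ, Ideal.Quotient.eq, Ideal.mem_span_singleton]
  have hf : π (f 1) = π (eulerProd N) := (hdvd _ _).2 (X_pow_dvd_f_one_sub N)
  have hP : ∀ n, N ≤ n → π (eulerProd n) = π (eulerProd N) := fun n hn =>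
    (hdvd _ _).2 (X_pow_dvd_eulerProd_sub hn)
  have h1 : ∀ n, π (eulerProd n) * π (eulerInv n) = 1 := fun n => by
    rw [← map_mul, eulerProd_mul_eulerInv, map_one]
  have hI : ∀ n, N ≤ n → π (eulerInv n) = π (eulerInv N) := fun n hn => by
    have h2 := h1 n
    rw [hP n hn] at h2
    linear_combination (-π (eulerInv n)) * h1 N + (π (eulerInv N)) * h2
  have hsmall : ∀ k < N, π (eulerProd N) * π (finiteJacobi (2 * N) k) =
      π (signedTriangular k) := fun k hk => by
    rw [finiteJacobi, show 2 * N + 1 - k = (2 * N - k) + 1 by omega, eulerInvPred]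
    simp only [map_mul]
    rw [hP (2 * (2 * N) + 1) (by omega), hI (2 * N - k) (by omega), hI (2 * N + k + 1) (by omega)]
    linear_combination (π (signedTriangular k) * (π (eulerProd N) * π (eulerInv N) + 1)) * h1 N
  have hlarge : ∀ k, N ≤ k → π (finiteJacobi (2 * N) k) = 0 := fun k hk => by
    have : π (signedTriangular k) = 0 := by
      rw [← map_zero π, hdvd, sub_zero, signedTriangular]
      refine Dvd.dvd.mul_left (pow_dvd_pow _ (hk.trans ?_)) _
      rcases k with _ | k
      · simp
      · rw [Nat.le_div_iff_mul_le two_pos]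
        exact Nat.mul_le_mul_left _ (by omega)
    rw [finiteJacobi]
    simp [this]
  rw [← hdvd, map_pow, hf, pow_succ', ← map_pow, ← hP (2 * N) (by omega)]
  have hS : π (eulerProd (2 * N) ^ 2) = π (eulerProd N ^ 2) := by
    rw [map_pow, hP (2 * N) (by omega), map_pow]
  rw [hP (2 * N) (by omega), ← hS, ← sum_finiteJacobi, map_sum, map_sum, mul_sum]
  rw [← sum_subset (s₁ := range N) (range_subset_range.2 (by omega))]
  · refine sum_congr rfl fun k hk => ?_
    rw [map_mul, map_mul, ← hsmall k (mem_range.1 hk)]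
    ring
  · intro k _ hk
    rw [map_mul, hlarge k (by simpa using hk), mul_zero, mul_zero]

theorem coeff_signedTriangular (n k : ℕ) :
    coeff n (signedTriangular k) = if k * (k + 1) / 2 = n then (-1 : ℤ) ^ k else 0 := by
  rw [signedTriangular, show ((-1) ^ k : ℤ⟦X⟧) = C ((-1) ^ k) by simp, coeff_C_mul, coeff_X_pow]
  simp [eq_comm]

theorem coeff_f_one_pow_three (n N : ℕ) (h : n < N) : coeff n (f 1 ^ 3) =
    ∑ k ∈ range N, if k * (k + 1) / 2 = n then (2 * k + 1 : ℤ) * (-1) ^ k else 0 := by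
  have h := X_pow_dvd_iff.mp (X_pow_dvd_f_one_pow_three_sub N) n h
  rw [map_sub, sub_eq_zero] at h
  rw [h, map_sum]
  refine sum_congr rfl fun k _ => ?_
  rw [show (2 * k + 1 : ℤ⟦X⟧) = C (2 * k + 1 : ℤ) by simp, coeff_C_mul, coeff_signedTriangular]
  simp

/-! ### The 7-dissections of f 1 and of its cube. -/

theorem continuous_expand {R : Type*} [CommRing R] [TopologicalSpace R] {r : ℕ} (hr : r ≠ 0) :
    Continuous (expand r hr : R⟦X⟧ →ₐ[R] R⟦X⟧) := by
  rw [continuous_iff_continuousAt]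
  intro g
  rw [ContinuousAt, PowerSeries.WithPiTopology.tendsto_iff_coeff_tendsto]
  intro n
  simp only [coeff_expand]
  split_ifs
  · exact (PowerSeries.WithPiTopology.continuous_coeff R _).continuousAt
  · exact tendsto_const_nhds

theorem expand_f {r s : ℕ} (hr : r ≠ 0) (hs : 1 ≤ s) : expand r hr (f s) = f (r * s) := by
  have h := (hasProd_f hs).map (expand r hr) (continuous_expand hr)
  refine h.unique ?_
  convert hasProd_f (r := r * s) (Nat.mul_pos (Nat.pos_of_ne_zero hr) hs) using 2 with n
  simp [← pow_mul, mul_assoc]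

theorem f_one_eq_pentagonalSeries : f 1 = pentagonalSeries ℤ := by
  rw [← PowerSeries.WithPiTopology.tprod_one_sub_X_pow, f]
  simp

/-- All exponents of `g` lie in the residue class `r` modulo `7`. -/
def HasResidue (r : ZMod 7) (g : ℤ⟦X⟧) : Prop := ∀ n : ℕ, (n : ZMod 7) ≠ r → coeff n g = 0

namespace HasResidue

variable {r s : ZMod 7} {g h : ℤ⟦X⟧}

theorem add (hg : HasResidue r g) (hh : HasResidue r h) : HasResidue r (g + h) := fun n hn => by
  rw [map_add, hg n hn, hh n hn, add_zero]

theorem sub (hg : HasResidue r g) (hh : HasResidue r h) : HasResidue r (g - h) := fun n hn => by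
  rw [map_sub, hg n hn, hh n hn, sub_zero]

theorem mul (hg : HasResidue r g) (hh : HasResidue s h) : HasResidue (r + s) (g * h) :=
  fun n hn => by
    rw [coeff_mul]
    refine sum_eq_zero fun p hp => ?_
    rw [HasAntidiagonal.mem_antidiagonal] at hp
    by_cases h1 : (p.1 : ZMod 7) = r
    · rw [hh p.2, mul_zero]
      rintro rfl
      apply hn
      rw [← hp, ← h1, Nat.cast_add]
    · rw [hg p.1 h1, zero_mul]

theorem const_mul (hg : HasResidue r g) (c : ℤ) : HasResidue r (C c * g) := fun n hn => by
  rw [coeff_C_mul, hg n hn, mul_zero]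

end HasResidue

theorem hasResidue_expand_seven {r : ℕ} (h7 : 7 ∣ r) (hr : r ≠ 0) (g : ℤ⟦X⟧) :
    HasResidue 0 (expand r hr g) := fun n hn => by
  refine coeff_expand_of_not_dvd _ _ _ fun hd => hn ?_
  exact (ZMod.natCast_eq_zero_iff _ _).2 (h7.trans hd)

theorem hasResidue_X_pow (k : ℕ) : HasResidue k (X ^ k) := fun n hn => by
  rw [coeff_X_pow, if_neg]
  rintro rfl
  exact hn rfl

/-- The part of `g` supported on the exponents in the residue class `r` modulo `7`. -/
noncomputable def residuePart (r : ZMod 7) (g : ℤ⟦X⟧) : ℤ⟦X⟧ :=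
  mk fun n => if (n : ZMod 7) = r then coeff n g else 0

theorem hasResidue_residuePart (r : ZMod 7) (g : ℤ⟦X⟧) : HasResidue r (residuePart r g) :=
  fun n hn => by rw [residuePart, coeff_mk, if_neg hn]

theorem two_mul_pentagonal_zmod (k : ℤ) :
    (2 : ZMod 7) * (pentagonal k : ℕ) = k * (3 * k - 1) := by
  exact_mod_cast congrArg (Int.cast : ℤ → ZMod 7) (two_mul_natCast_pentagonal k)

theorem pentagonal_seven_mul_sub_one (k : ℤ) : pentagonal (7 * k - 1) = 49 * pentagonal k + 2 := by
  have h1 := two_mul_natCast_pentagonal (7 * k - 1)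
  have h2 := two_mul_natCast_pentagonal k
  zify
  linarith

theorem coeff_f_one_eq_zero {n : ℕ} (hn : (n : ZMod 7) = 3 ∨ (n : ZMod 7) = 4 ∨ (n : ZMod 7) = 6) :
    coeff n (f 1) = 0 := by
  rw [f_one_eq_pentagonalSeries]
  refine coeff_pentagonalSeries_eq_zero _ ?_
  rintro ⟨k, rfl⟩
  have h := two_mul_pentagonal_zmod k
  generalize ((pentagonal k : ℕ) : ZMod 7) = t at *
  generalize ((k : ℤ) : ZMod 7) = u at *
  revert t u
  decide

/-- The series `q ^ 2 f_49`. -/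
noncomputable def shiftedF : ℤ⟦X⟧ := X ^ 2 * f 49

theorem shiftedF_eq : shiftedF = X ^ 2 * expand 49 (by norm_num) (f 1) := by
  rw [shiftedF, expand_f _ le_rfl]

theorem coeff_X_pow_mul_expand {r : ℕ} (hr : r ≠ 0) (k n : ℕ) (g : ℤ⟦X⟧) :
    coeff (r * n + k) (X ^ k * expand r hr g) = coeff n g := by
  rw [coeff_X_pow_mul, coeff_expand_mul]

theorem coeff_X_pow_mul_expand_eq_zero {r : ℕ} (hr : r ≠ 0) {k n : ℕ} (g : ℤ⟦X⟧)
    (h : ∀ l, n ≠ r * l + k) : coeff n (X ^ k * expand r hr g) = 0 := by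
  rw [coeff_X_pow_mul']
  split_ifs with hk
  · refine coeff_expand_of_not_dvd _ _ _ fun ⟨l, hl⟩ => h l ?_
    omega
  · rfl

/-- The congruence k(3k-1) ≡ 4 modulo 7 has the double root k ≡ -1. For k = 7l - 1 the pentagonal
number is 49 times that of l, plus 2, and the sign (-1)^k is opposite to (-1)^l. -/
theorem coeff_f_one_of_residue_two {n : ℕ} (hn : (n : ZMod 7) = 2) :
    coeff n (f 1) = -coeff n shiftedF := by
  rw [shiftedF_eq]
  by_cases h : n ∈ Set.range pentagonal
  · obtain ⟨k, rfl⟩ := h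
    have h2 := two_mul_pentagonal_zmod k
    rw [hn] at h2
    have h3 : ((k + 1 : ℤ) : ZMod 7) = 0 := by
      push_cast
      generalize ((k : ℤ) : ZMod 7) = u at *
      revert u
      decide
    rw [ZMod.intCast_zmod_eq_zero_iff_dvd] at h3
    obtain ⟨l, hl⟩ := h3
    obtain rfl : k = 7 * l - 1 := by push_cast at hl; omega
    rw [pentagonal_seven_mul_sub_one, coeff_X_pow_mul_expand, ← pentagonal_seven_mul_sub_one,
      f_one_eq_pentagonalSeries, coeff_pentagonalSeries_pentagonal,
      coeff_pentagonalSeries_pentagonal]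
    rcases Int.even_or_odd l with hl | hl
    · rw [Int.negOnePow_even l hl, Int.negOnePow_odd (7 * l - 1) (by grind)]
      simp
    · rw [Int.negOnePow_odd l hl, Int.negOnePow_even (7 * l - 1) (by grind)]
      simp
  · rw [f_one_eq_pentagonalSeries, coeff_pentagonalSeries_eq_zero _ h, eq_comm, neg_eq_zero]
    by_cases hl : ∃ l, n = 49 * l + 2
    · obtain ⟨l, rfl⟩ := hl
      rw [coeff_X_pow_mul_expand]
      refine coeff_pentagonalSeries_eq_zero ℤ ?_
      rintro ⟨k, rfl⟩
      exact h ⟨7 * k - 1, pentagonal_seven_mul_sub_one k⟩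
    · exact coeff_X_pow_mul_expand_eq_zero _ _ fun l hn => hl ⟨l, hn⟩

/-- The part of `f 1` with exponents congruent to `r` modulo `7`. -/
noncomputable def part (r : ZMod 7) : ℤ⟦X⟧ := residuePart r (f 1)

theorem hasResidue_shiftedF : HasResidue 2 shiftedF := by
  rw [shiftedF_eq]
  exact (hasResidue_X_pow 2).mul (hasResidue_expand_seven (by norm_num) _ _)

theorem f_one_eq_sum_parts : f 1 = part 0 + part 1 + part 5 - shiftedF := by
  ext n
  simp only [part, residuePart, map_add, map_sub, coeff_mk]
  by_cases h2 : (n : ZMod 7) = 2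
  · rw [coeff_f_one_of_residue_two h2, if_neg (by rw [h2]; decide), if_neg (by rw [h2]; decide),
      if_neg (by rw [h2]; decide)]
    ring
  · rw [hasResidue_shiftedF n h2]
    have hcases : ∀ t : ZMod 7, t ≠ 2 → t = 0 ∨ t = 1 ∨ t = 5 ∨ t = 3 ∨ t = 4 ∨ t = 6 := by decide
    rcases hcases _ h2 with h | h | h | h
    · rw [h, if_pos rfl, if_neg (by decide), if_neg (by decide)]
      ring
    · rw [h, if_neg (by decide), if_pos rfl, if_neg (by decide)]
      ring
    · rw [h, if_neg (by decide), if_neg (by decide), if_pos rfl]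
      ring
    · rw [coeff_f_one_eq_zero h]
      simp

theorem two_mul_triangular_zmod (k : ℕ) :
    (2 : ZMod 7) * (k * (k + 1) / 2 : ℕ) = k * (k + 1) := by
  have := Nat.two_mul_div_two_of_even (Nat.even_mul_succ_self k)
  exact_mod_cast congrArg (Nat.cast : ℕ → ZMod 7) this

/-- Triangular numbers lie in the classes 0, 1, 3, 6 modulo 7. -/
theorem coeff_f_one_pow_three_eq_zero {n : ℕ}
    (hn : (n : ZMod 7) = 2 ∨ (n : ZMod 7) = 4 ∨ (n : ZMod 7) = 5) : coeff n (f 1 ^ 3) = 0 := by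
  rw [coeff_f_one_pow_three n _ (Nat.lt_succ_self n)]
  refine sum_eq_zero fun k _ => if_neg ?_
  rintro rfl
  have h := two_mul_triangular_zmod k
  generalize ((k * (k + 1) / 2 : ℕ) : ZMod 7) = t at *
  generalize (k : ZMod 7) = u at *
  revert t u
  decide

theorem triangular_seven_mul_add_three (k : ℕ) :
    (7 * k + 3) * (7 * k + 3 + 1) / 2 = 49 * (k * (k + 1) / 2) + 6 := by
  have h1 := Nat.two_mul_div_two_of_even (Nat.even_mul_succ_self (7 * k + 3))
  have h2 := Nat.two_mul_div_two_of_even (Nat.even_mul_succ_self k)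
  linarith

theorem shiftedF_pow_three : shiftedF ^ 3 = X ^ 6 * expand 49 (by norm_num) (f 1 ^ 3) := by
  rw [shiftedF_eq, map_pow]
  ring

theorem coeff_f_one_pow_three_of_residue_six {n : ℕ} (hn : (n : ZMod 7) = 6) :
    coeff n (f 1 ^ 3) = -7 * coeff n (shiftedF ^ 3) := by
  have hsum : coeff n (f 1 ^ 3) = ∑ k ∈ range (n + 1),
      if 49 * (k * (k + 1) / 2) + 6 = n then -7 * ((2 * k + 1 : ℤ) * (-1) ^ k) else 0 := by
    rw [coeff_f_one_pow_three n (7 * (n + 1)) (by omega)]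
    symm
    -- k ≡ 3 is the double root of k(k+1) ≡ 5 modulo 7. The weight 2(7k+3)+1 = 7(2k+1) and the sign
    -- change supply the factor -7.
    refine sum_of_injOn (fun k => 7 * k + 3) (fun a _ b _ h => by simpa using h) ?_ ?_ ?_
    · intro k hk
      simp only [coe_range, Set.mem_Iio] at hk ⊢
      omega
    · intro k hk hk'
      refine if_neg ?_
      rintro rfl
      have h := two_mul_triangular_zmod k
      rw [hn] at h
      have h3 : (k : ZMod 7) = (3 : ℕ) := by
        generalize (k : ZMod 7) = u at *
        revert u
        decide
      rw [ZMod.natCast_eq_natCast_iff'] at h3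
      refine hk' ⟨k / 7, ?_, ?_⟩
      · simp only [mem_range, coe_range, Set.mem_Iio] at hk ⊢
        omega
      · show 7 * (k / 7) + 3 = k
        omega
    · intro k _
      rw [triangular_seven_mul_add_three]
      refine if_congr Iff.rfl ?_ rfl
      rw [pow_add, pow_mul]
      push_cast
      norm_num
      ring
  rw [hsum, shiftedF_pow_three]
  by_cases h : ∃ l, n = 49 * l + 6
  · obtain ⟨l, rfl⟩ := h
    rw [coeff_X_pow_mul_expand, coeff_f_one_pow_three l (49 * l + 6 + 1) (by omega), mul_sum]
    refine sum_congr rfl fun k _ => ?_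
    rw [mul_ite, mul_zero]
    exact if_congr (by omega) rfl rfl
  · rw [coeff_X_pow_mul_expand_eq_zero _ _ (fun l hl => h ⟨l, hl⟩), mul_zero]
    exact sum_eq_zero fun k _ => if_neg fun hk => h ⟨_, hk.symm⟩

/-- The part of a sum of seven series, one for each residue class. -/
theorem coeff_sum_of_hasResidue {Y : ZMod 7 → ℤ⟦X⟧} (hY : ∀ r, HasResidue r (Y r)) (n : ℕ) :
    coeff n (∑ r, Y r) = coeff n (Y n) := by
  rw [map_sum, Fintype.sum_eq_single (n : ZMod 7)]
  intro r hr
  exact hY r n hr.symm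

/-- The parts of `f 1 ^ 3`, expressed by those of `f 1`. -/
noncomputable def cubePart : Fin 7 → ℤ⟦X⟧
  | 0 => part 0 * part 0 * part 0 + C 3 * (part 1 * part 1 * part 5)
      - C 6 * (part 0 * part 5 * shiftedF)
  | 1 => part 5 * part 5 * part 5 + C 3 * (part 0 * part 0 * part 1)
      - C 6 * (part 1 * part 5 * shiftedF)
  | 2 => C 3 * (part 0 * part 1 * part 1 + part 5 * shiftedF * shiftedF
      - part 0 * part 0 * shiftedF)
  | 3 => part 1 * part 1 * part 1 + C 3 * (part 0 * part 5 * part 5)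
      - C 6 * (part 0 * part 1 * shiftedF)
  | 4 => C 3 * (part 1 * part 5 * part 5 + part 0 * shiftedF * shiftedF
      - part 1 * part 1 * shiftedF)
  | 5 => C 3 * (part 0 * part 0 * part 5 + part 1 * shiftedF * shiftedF
      - part 5 * part 5 * shiftedF)
  | 6 => C 6 * (part 0 * part 1 * part 5) - shiftedF * shiftedF * shiftedF

theorem hasResidue_cubePart (r : Fin 7) : HasResidue (r : ZMod 7) (cubePart r) := by
  have h0 : HasResidue 0 (part 0) := hasResidue_residuePart 0 _
  have h1 : HasResidue 1 (part 1) := hasResidue_residuePart 1 _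
  have h5 : HasResidue 5 (part 5) := hasResidue_residuePart 5 _
  have hE := hasResidue_shiftedF
  have tri {r s t u : ZMod 7} {a b c : ℤ⟦X⟧} (ha : HasResidue r a) (hb : HasResidue s b)
      (hc : HasResidue t c) (h : r + s + t = u) : HasResidue u (a * b * c) :=
    h ▸ (ha.mul hb).mul hc
  match r with
  | 0 => exact ((tri h0 h0 h0 rfl).add ((tri h1 h1 h5 rfl).const_mul 3)).sub
          ((tri h0 h5 hE rfl).const_mul 6)
  | 1 => exact ((tri h5 h5 h5 rfl).add ((tri h0 h0 h1 rfl).const_mul 3)).sub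
          ((tri h1 h5 hE rfl).const_mul 6)
  | 2 => exact (((tri h0 h1 h1 rfl).add (tri h5 hE hE rfl)).sub (tri h0 h0 hE rfl)).const_mul 3
  | 3 => exact ((tri h1 h1 h1 rfl).add ((tri h0 h5 h5 rfl).const_mul 3)).sub
          ((tri h0 h1 hE rfl).const_mul 6)
  | 4 => exact (((tri h1 h5 h5 rfl).add (tri h0 hE hE rfl)).sub (tri h1 h1 hE rfl)).const_mul 3
  | 5 => exact (((tri h0 h0 h5 rfl).add (tri h1 hE hE rfl)).sub (tri h5 h5 hE rfl)).const_mul 3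
  | 6 => exact ((tri h0 h1 h5 rfl).const_mul 6).sub (tri hE hE hE rfl)

/-- A nonzero integer is nonzero in `ℤ⟦X⟧`. -/
theorem C_ne_zero {c : ℤ} (hc : c ≠ 0) : (C c : ℤ⟦X⟧) ≠ 0 := fun h =>
  hc (by simpa using congrArg constantCoeff h)

theorem f_one_pow_three_eq_sum : f 1 ^ 3 = ∑ r : ZMod 7, cubePart r := by
  have : ∑ r : ZMod 7, cubePart r = cubePart 0 + cubePart 1 + cubePart 2 + cubePart 3 + cubePart 4
      + cubePart 5 + cubePart 6 := Fin.sum_univ_seven _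
  rw [this, f_one_eq_sum_parts]
  have h3 : (C 3 : ℤ⟦X⟧) = 3 := rfl
  have h6 : (C 6 : ℤ⟦X⟧) = 6 := rfl
  simp only [cubePart, h3, h6]
  ring

/-- Expanding (A + B + D - E)^3 by residue classes, the components in classes absent from Jacobi's
series must vanish. -/
theorem cubePart_eq_zero {r : ZMod 7} (hr : r = 2 ∨ r = 4 ∨ r = 5) : cubePart r = 0 := by
  ext n
  rw [map_zero]
  by_cases hn : (n : ZMod 7) = r
  · subst hn
    rw [← coeff_sum_of_hasResidue hasResidue_cubePart, ← f_one_pow_three_eq_sum,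
      coeff_f_one_pow_three_eq_zero hr]
  · exact hasResidue_cubePart r n hn

theorem cubePart_six : cubePart 6 = -7 * shiftedF ^ 3 := by
  ext n
  rw [show (-7 : ℤ⟦X⟧) = C (-7) by simp, coeff_C_mul]
  by_cases hn : (n : ZMod 7) = 6
  · rw [← coeff_f_one_pow_three_of_residue_six hn, f_one_pow_three_eq_sum,
      coeff_sum_of_hasResidue hasResidue_cubePart, hn]
    rfl
  · have h := (hasResidue_shiftedF.mul hasResidue_shiftedF).mul hasResidue_shiftedF
    rw [hasResidue_cubePart 6 n hn, show shiftedF ^ 3 = shiftedF * shiftedF * shiftedF by ring,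
      h n hn, mul_zero]

/-- Class 6 of the cube reads 6ABD - E^3 = -7E^3. -/
theorem parts_mul : part 0 * part 1 * part 5 + shiftedF ^ 3 = 0 := by
  have h := cubePart_six
  have h6 : (C 6 : ℤ⟦X⟧) = 6 := rfl
  simp only [cubePart, h6] at h
  have h2 : (6 : ℤ⟦X⟧) * (part 0 * part 1 * part 5 + shiftedF ^ 3) = 0 := by
    linear_combination h
  exact (mul_eq_zero.mp h2).resolve_left (h6 ▸ C_ne_zero (by norm_num))

theorem parts_relation_two :
    part 5 * shiftedF ^ 2 - part 0 ^ 2 * shiftedF + part 1 ^ 2 * part 0 = 0 := by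
  have h := cubePart_eq_zero (r := 2) (by decide)
  have h3 : (C 3 : ℤ⟦X⟧) = 3 := rfl
  simp only [cubePart, h3] at h
  linear_combination (mul_eq_zero.mp h).resolve_left (h3 ▸ C_ne_zero (by norm_num))

theorem parts_relation_four :
    part 0 * shiftedF ^ 2 - part 1 ^ 2 * shiftedF + part 5 ^ 2 * part 1 = 0 := by
  have h := cubePart_eq_zero (r := 4) (by decide)
  have h3 : (C 3 : ℤ⟦X⟧) = 3 := rfl
  simp only [cubePart, h3] at h
  linear_combination (mul_eq_zero.mp h).resolve_left (h3 ▸ C_ne_zero (by norm_num))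

theorem parts_relation_five :
    part 1 * shiftedF ^ 2 - part 5 ^ 2 * shiftedF + part 0 ^ 2 * part 5 = 0 := by
  have h := cubePart_eq_zero (r := 5) (by decide)
  have h3 : (C 3 : ℤ⟦X⟧) = 3 := rfl
  simp only [cubePart, h3] at h
  linear_combination (mul_eq_zero.mp h).resolve_left (h3 ▸ C_ne_zero (by norm_num))

/-! ### The degree-seven equation for f 1. -/

/-- The norm form of the seven-term equation satisfied by `A + B + D - E`. -/
theorem sq_eq_of_relations {R : Type*} [CommRing R] {A B D E : R} (h0 : A * B * D + E ^ 3 = 0)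
    (h1 : B * E ^ 2 - D ^ 2 * E + A ^ 2 * D = 0) (h2 : A * E ^ 2 - B ^ 2 * E + D ^ 2 * B = 0)
    (h3 : D * E ^ 2 - A ^ 2 * E + B ^ 2 * A = 0) {F V : R} (hF : F = A + B + D - E)
    (hV : V = -(A ^ 3 * B + B ^ 3 * D + D ^ 3 * A) - 8 * E ^ 4) :
    E * (F ^ 7 + 7 * F ^ 6 * E + 21 * F ^ 5 * E ^ 2 + 49 * F ^ 4 * E ^ 3 + 147 * F ^ 3 * E ^ 4
      + 343 * F ^ 2 * E ^ 5 + 343 * F * E ^ 6)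
      + V * (7 * F ^ 3 * E + 35 * F ^ 2 * E ^ 2 + 49 * F * E ^ 3) - V ^ 2 = 0 := by
  subst hF hV
  -- The cofactors certify that, once F and V are expanded in A, B, D, E, the polynomial lies in the
  -- ideal of the four cubic relations.
  linear_combination (21 * D ^ 4 * E - 14 * B * D ^ 2 * E ^ 2 - 35 * B ^ 2 * E ^ 3 - 28 * A * E
    ^ 4 + 35 * A * B ^ 3 * D + 196 * A ^ 2 * B * D * E - 7 * A ^ 4 * B - 35 * D ^ 2 * E ^ 3 - 35
    * B * E ^ 4 + 7 * B ^ 4 * D + 21 * A * B * D ^ 3 + 203 * A * B ^ 2 * D * E - 7 * A ^ 2 * D *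
    E ^ 2 - 7 * A ^ 3 * B ^ 2 + 14 * A ^ 4 * E - 9 * E ^ 5 - 2 * B ^ 2 * D ^ 3 + 64 * B ^ 3 * D
    * E + 64 * A * D ^ 3 * E + 6 * A * B * D * E ^ 2 - 3 * A ^ 2 * B ^ 3 - 2 * A ^ 3 * D ^ 2 +
    60 * A ^ 3 * B * E + 84 * B * D ^ 3 * E - 28 * B ^ 2 * D * E ^ 2 - 84 * A * D * E ^ 3 + 112
    * A ^ 2 * B ^ 2 * E - 28 * D ^ 3 * E ^ 2 - 56 * B * D * E ^ 3 + 28 * A * B ^ 2 * D ^ 2 + 84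
    * A * B ^ 3 * E + 112 * A ^ 2 * D ^ 2 * E - 28 * D * E ^ 4 + 21 * B ^ 4 * E + 7 * A * D ^ 4
    + 196 * A * B * D ^ 2 * E - 7 * A * B ^ 2 * E ^ 2 - 42 * A ^ 2 * E ^ 3 + 14 * A ^ 3 * B * D
    + 112 * B ^ 2 * D ^ 2 * E - 28 * B ^ 3 * E ^ 2 - 28 * A * D ^ 2 * E ^ 2 - 56 * A * B * E ^ 3
    + 28 * A ^ 2 * B ^ 2 * D + 84 * A ^ 3 * D * E) * h0 + (7 * D ^ 2 * E ^ 3 - 7 * B * E ^ 4 -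
    14 * B ^ 4 * D + 7 * A ^ 2 * D * E ^ 2 + 7 * A ^ 3 * B ^ 2 + 7 * A ^ 4 * E + 7 * E ^ 5 - 21
    * B ^ 2 * D ^ 3 - 7 * B ^ 3 * D * E + 14 * A * D ^ 3 * E + 7 * A ^ 2 * B ^ 3 + 7 * A ^ 3 * B
    * E - 1 * D ^ 5 - 1 * B * D ^ 3 * E - 3 * B ^ 2 * D * E ^ 2 + 3 * A * D * E ^ 3 + 1 * A * B
    ^ 4 + 3 * A ^ 2 * B ^ 2 * E + 1 * A ^ 3 * E ^ 2 + 28 * B * D * E ^ 3 + 28 * A ^ 2 * D ^ 2 *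
    E - 28 * A ^ 2 * B * E ^ 2 - 28 * D * E ^ 4 - 28 * B ^ 3 * D ^ 2 - 28 * A * B ^ 2 * E ^ 2 -
    7 * B * D ^ 4 - 7 * B ^ 2 * D ^ 2 * E - 7 * B ^ 3 * E ^ 2 + 7 * A * D ^ 2 * E ^ 2 + 7 * A *
    B * E ^ 3 + 21 * A ^ 3 * D * E + 28 * B ^ 2 * E ^ 3 - 28 * A * E ^ 4) * h1 + (-21 * A ^ 2 *
    B ^ 3 - 7 * A * B ^ 4 - 1 * B ^ 5 - 14 * A ^ 4 * B - 28 * A ^ 3 * B ^ 2) * h2 + (-1 * A ^ 5)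
    * h3

/-- A quartic form in the parts of `f 1`; it equals `q f_7 ^ 4`. -/
noncomputable def quarticPart : ℤ⟦X⟧ :=
  -(part 0 ^ 3 * part 1 + part 1 ^ 3 * part 5 + part 5 ^ 3 * part 0) - 8 * shiftedF ^ 4

theorem quarticPart_sq_eq :
    shiftedF * (f 1 ^ 7 + 7 * f 1 ^ 6 * shiftedF + 21 * f 1 ^ 5 * shiftedF ^ 2
      + 49 * f 1 ^ 4 * shiftedF ^ 3 + 147 * f 1 ^ 3 * shiftedF ^ 4
      + 343 * f 1 ^ 2 * shiftedF ^ 5 + 343 * f 1 * shiftedF ^ 6)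
      + quarticPart * (7 * f 1 ^ 3 * shiftedF + 35 * f 1 ^ 2 * shiftedF ^ 2
        + 49 * f 1 * shiftedF ^ 3) - quarticPart ^ 2 = 0 :=
  sq_eq_of_relations parts_mul parts_relation_five parts_relation_four parts_relation_two
    f_one_eq_sum_parts rfl

/-! ### Vieta's and Newton's formulas for a polynomial with d known distinct roots. -/

section Roots

variable {R : Type*} [CommRing R]

/-- The difference of the two sides has degree below d and vanishes at d distinct points of a
domain. The leading coefficient is left arbitrary because it is E in the first application. -/
theorem sum_C_mul_X_pow_eq_prod_of_roots [IsDomain R] {d : ℕ} {z : Fin d → R}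
    (hz : Function.Injective z) {a : ℕ → R}
    (h : ∀ k, ∑ i ∈ range (d + 1), a i * z k ^ i = 0) :
    ∑ i ∈ range (d + 1), Polynomial.C (a i) * Polynomial.X ^ i =
      Polynomial.C (a d) * ∏ k, (Polynomial.X - Polynomial.C (z k)) := by
  rw [← sub_eq_zero]
  have hmonic : (∏ k, (Polynomial.X - Polynomial.C (z k))).Monic :=
    Polynomial.monic_prod_of_monic _ _ fun k _ => Polynomial.monic_X_sub_C _
  have hdeg : (∏ k, (Polynomial.X - Polynomial.C (z k))).natDegree = d := by
    rw [Polynomial.natDegree_prod_of_monic _ _ fun k _ => Polynomial.monic_X_sub_C _]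
    simp
  refine Polynomial.eq_zero_of_degree_lt_of_eval_index_eq_zero (ι := Fin d) (v := z) univ hz.injOn ?_ ?_
  · rw [card_univ, Fintype.card_fin, Polynomial.degree_lt_iff_coeff_zero]
    intro n hn
    rw [Polynomial.coeff_sub, Polynomial.finsetSum_coeff, Polynomial.coeff_C_mul]
    simp only [Polynomial.coeff_C_mul_X_pow]
    rcases hn.eq_or_lt with rfl | hn
    · have h1 := hmonic.coeff_natDegree
      rw [hdeg] at h1
      simp [h1]
    · rw [Polynomial.coeff_eq_zero_of_natDegree_lt (by rwa [hdeg]), mul_zero, sub_zero]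
      refine sum_eq_zero fun i hi => if_neg ?_
      rw [mem_range] at hi
      omega
  · intro k _
    rw [Polynomial.eval_sub, Polynomial.eval_mul, Polynomial.eval_prod,
      prod_eq_zero (mem_univ k) (by simp), mul_zero, sub_zero, Polynomial.eval_finsetSum]
    simpa using h k

theorem coeff_zero_eq_of_roots [IsDomain R] {d : ℕ} {z : Fin d → R}
    (hz : Function.Injective z) {a : ℕ → R}
    (h : ∀ k, ∑ i ∈ range (d + 1), a i * z k ^ i = 0) : a 0 = (-1) ^ d * (a d * ∏ k, z k) := by
  have := congrArg (Polynomial.eval 0) (sum_C_mul_X_pow_eq_prod_of_roots hz h)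
  rw [Polynomial.eval_finsetSum, Polynomial.eval_mul, Polynomial.eval_prod] at this
  simp only [Polynomial.eval_mul, Polynomial.eval_C, Polynomial.eval_pow, Polynomial.eval_X,
    Polynomial.eval_sub, zero_sub, prod_neg, card_univ, Fintype.card_fin] at this
  rw [sum_eq_single 0 (by simp +contextual) (by simp)] at this
  linear_combination this

theorem esymm_eq_of_roots [IsDomain R] {d : ℕ} {z : Fin d → R}
    (hz : Function.Injective z) {a : ℕ → R} (ha : a d = 1)
    (h : ∀ k, ∑ i ∈ range (d + 1), a i * z k ^ i = 0) {j : ℕ} (hj : j ≤ d) :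
    MvPolynomial.aeval z (MvPolynomial.esymm (Fin d) R j) = (-1) ^ j * a (d - j) := by
  have h1 := congrArg (Polynomial.coeff · (d - j)) (sum_C_mul_X_pow_eq_prod_of_roots hz h)
  have h2 : ∏ k, (Polynomial.X - Polynomial.C (z k)) =
      ((univ.val.map z).map fun t => Polynomial.X - Polynomial.C t).prod := by
    rw [Multiset.map_map]
    rfl
  rw [ha, map_one, one_mul, h2, Multiset.prod_X_sub_C_coeff _ (by simp)] at h1
  simp only [Multiset.card_map, card_val, card_univ, Fintype.card_fin, Nat.sub_sub_self hj] at h1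
  rw [← MvPolynomial.aeval_esymm_eq_multiset_esymm (Fin d) R, Polynomial.finsetSum_coeff] at h1
  simp only [Polynomial.coeff_C_mul_X_pow] at h1
  rw [sum_ite_eq, if_pos (mem_range.2 (by omega))] at h1
  rw [h1, ← mul_assoc, ← pow_add, Even.neg_one_pow ⟨j, rfl⟩, one_mul]

theorem powerSum_eq_of_roots [IsDomain R] {d : ℕ} {z : Fin d → R}
    (hz : Function.Injective z) {a : ℕ → R} (ha : a d = 1)
    (h : ∀ k, ∑ i ∈ range (d + 1), a i * z k ^ i = 0) {j : ℕ} (hj0 : 0 < j) (hj : j ≤ d) :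
    ∑ k, z k ^ j = -(j * a (d - j)) - ∑ i ∈ Ico 1 j, a (d - i) * ∑ k, z k ^ (j - i) := by
  have h1 := congrArg (MvPolynomial.aeval z) (MvPolynomial.psum_eq_mul_esymm_sub_sum (Fin d) R j hj0)
  have hp : ∀ i, MvPolynomial.aeval z (MvPolynomial.psum (Fin d) R i) = ∑ k, z k ^ i := fun i => by
    simp [MvPolynomial.psum]
  rw [map_sub, map_sum, map_mul, map_mul, hp, esymm_eq_of_roots hz ha h hj] at h1
  rw [h1]
  congr 1
  · simp only [map_pow, map_neg, map_one, map_natCast]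
    have : ((-1 : R) ^ j) * (-1) ^ j = 1 := by rw [← pow_add, Even.neg_one_pow ⟨j, rfl⟩]
    linear_combination (-(j * a (d - j))) * this
  · refine sum_nbij' (fun p => p.1) (fun i => (i, j - i)) ?_ ?_ ?_ ?_ ?_
    · intro p hp
      simp only [mem_filter, HasAntidiagonal.mem_antidiagonal, Set.mem_Ioo] at hp
      simp only [mem_Ico]
      omega
    · intro i hi
      simp only [mem_Ico] at hi
      simp only [mem_filter, HasAntidiagonal.mem_antidiagonal, Set.mem_Ioo]
      omega
    · intro p hp
      simp only [mem_filter, HasAntidiagonal.mem_antidiagonal, Set.mem_Ioo] at hp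
      refine Prod.ext rfl ?_
      show j - p.1 = p.2
      omega
    · intro i _
      rfl
    · intro p hp'
      simp only [mem_filter, HasAntidiagonal.mem_antidiagonal, Set.mem_Ioo] at hp'
      rw [map_mul, map_mul, hp, esymm_eq_of_roots hz ha h (by omega),
        show j - p.1 = p.2 by omega]
      simp only [map_pow, map_neg, map_one]
      rw [← mul_assoc, ← pow_add, Even.neg_one_pow ⟨p.1, rfl⟩, one_mul]

end Roots

/-! ### Conjugates under q ↦ ζ^k q, and the evaluation of the quartic form. -/

/-- A primitive seventh root of unity. -/
noncomputable def zeta : ℂ := Complex.exp (2 * Real.pi * Complex.I / (7 : ℕ))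

theorem isPrimitiveRoot_zeta : IsPrimitiveRoot zeta 7 :=
  Complex.isPrimitiveRoot_exp 7 (by norm_num)

/-- The inclusion `ℤ⟦X⟧ → ℂ⟦X⟧`. -/
noncomputable def toComplex : ℤ⟦X⟧ →+* ℂ⟦X⟧ := PowerSeries.map (Int.castRingHom ℂ)

theorem coeff_toComplex (n : ℕ) (g : ℤ⟦X⟧) : coeff n (toComplex g) = (coeff n g : ℤ) := by
  simp [toComplex]

theorem toComplex_injective : Function.Injective toComplex := fun g h hgh => by
  ext n
  have := congrArg (coeff n) hgh
  rw [coeff_toComplex, coeff_toComplex] at this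
  exact_mod_cast this

theorem continuous_toComplex : Continuous toComplex := by
  rw [continuous_iff_continuousAt]
  intro g
  rw [ContinuousAt, PowerSeries.WithPiTopology.tendsto_iff_coeff_tendsto]
  intro n
  simp only [coeff_toComplex]
  exact (continuous_of_discreteTopology (f := (Int.cast : ℤ → ℂ))).continuousAt.comp
    (PowerSeries.WithPiTopology.continuous_coeff ℤ n).continuousAt

theorem continuous_rescale (c : ℂ) : Continuous (rescale c : ℂ⟦X⟧ →+* ℂ⟦X⟧) := by
  rw [continuous_iff_continuousAt]
  intro g
  rw [ContinuousAt, PowerSeries.WithPiTopology.tendsto_iff_coeff_tendsto]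
  intro n
  simp only [coeff_rescale]
  exact (continuous_const.mul (PowerSeries.WithPiTopology.continuous_coeff ℂ n)).continuousAt

/-- The conjugate `g (ζ ^ k X)` of `g`. -/
noncomputable def conjugate (k : Fin 7) : ℤ⟦X⟧ →+* ℂ⟦X⟧ :=
  (rescale (zeta ^ (k : ℕ))).comp toComplex

theorem coeff_conjugate (k : Fin 7) (g : ℤ⟦X⟧) (n : ℕ) :
    coeff n (conjugate k g) = (zeta ^ (k : ℕ)) ^ n * (coeff n g : ℤ) := by
  rw [conjugate, RingHom.comp_apply, coeff_rescale, coeff_toComplex]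

theorem conjugate_of_hasResidue {r : ℕ} {g : ℤ⟦X⟧} (hg : HasResidue r g) (k : Fin 7) :
    conjugate k g = C (zeta ^ (k : ℕ)) ^ r * toComplex g := by
  ext n
  rw [coeff_conjugate, ← map_pow, coeff_C_mul, coeff_toComplex]
  by_cases h : (n : ZMod 7) = r
  · rw [ZMod.natCast_eq_natCast_iff] at h
    congr 1
    refine pow_eq_pow_of_modEq h ?_
    rw [← pow_mul, mul_comm, pow_mul, isPrimitiveRoot_zeta.pow_eq_one, one_pow]
  · rw [hg n h]
    simp

theorem prod_one_sub_zeta_pow_mul (n : ℕ) (y : ℂ⟦X⟧) :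
    ∏ k : Fin 7, (1 - C ((zeta ^ (k : ℕ)) ^ n) * y) = if 7 ∣ n then (1 - y) ^ 7 else 1 - y ^ 7 := by
  have hcomm : ∀ k : ℕ, (zeta ^ k) ^ n = (zeta ^ n) ^ k := fun k => by
    rw [← pow_mul, ← pow_mul, mul_comm]
  classical
  split_ifs with h
  · simp [hcomm, (isPrimitiveRoot_zeta.pow_eq_one_iff_dvd n).2 h]
  · have hη : IsPrimitiveRoot (C (zeta ^ n) : ℂ⟦X⟧) 7 :=
      (isPrimitiveRoot_zeta.pow_of_coprime n
        (((Nat.Prime.coprime_iff_not_dvd (by norm_num)).2 h).symm)).map_of_injective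
        (f := C) C_injective
    have himage : Polynomial.nthRootsFinset 7 (1 : ℂ⟦X⟧) =
        (range 7).image fun k => (C (zeta ^ n) : ℂ⟦X⟧) ^ k := by
      symm
      refine eq_of_subset_of_card_le ?_ ?_
      · intro u hu
        rw [mem_image] at hu
        obtain ⟨k, -, rfl⟩ := hu
        rw [Polynomial.mem_nthRootsFinset (by norm_num), ← pow_mul, mul_comm, pow_mul,
          hη.pow_eq_one, one_pow]
      · rw [hη.card_nthRootsFinset, card_image_of_injOn, card_range]
        intro i hi j hj hij
        exact hη.pow_inj (by simpa using hi) (by simpa using hj) hij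
    have := hη.pow_sub_pow_eq_prod_sub_mul 1 y (by norm_num)
    rw [one_pow] at this
    rw [this, himage, prod_image, prod_range]
    · refine prod_congr rfl fun k _ => ?_
      rw [hcomm, map_pow]
    · intro i hi j hj hij
      exact hη.pow_inj (by simpa using hi) (by simpa using hj) hij

theorem sum_conjugate (g : ℤ⟦X⟧) : ∑ k, conjugate k g =
    7 * toComplex (residuePart 0 g) := by
  ext n
  rw [show (7 : ℂ⟦X⟧) = C 7 from rfl, coeff_C_mul, coeff_toComplex, map_sum, residuePart, coeff_mk]
  simp only [coeff_conjugate]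
  rw [← sum_mul]
  have hcomm : ∀ k : ℕ, (zeta ^ k) ^ n = (zeta ^ n) ^ k := fun k => by
    rw [← pow_mul, ← pow_mul, mul_comm]
  simp only [hcomm, ZMod.natCast_eq_zero_iff]
  split_ifs with h
  · simp [(isPrimitiveRoot_zeta.pow_eq_one_iff_dvd n).2 h]
  · rw [← sum_range (f := fun k => (zeta ^ n) ^ k),
      (isPrimitiveRoot_zeta.pow_of_coprime n
        (((Nat.Prime.coprime_iff_not_dvd (by norm_num)).2 h).symm)).geom_sum_eq_zero (by norm_num)]
    simp

theorem hasProd_toComplex_f {r : ℕ} (hr : 1 ≤ r) :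
    HasProd (fun m : ℕ => (1 - X ^ (r * (m + 1)) : ℂ⟦X⟧)) (toComplex (f r)) := by
  convert (hasProd_f hr).map toComplex continuous_toComplex using 2 with m
  simp [toComplex]

theorem hasProd_conjugate_f_one (k : Fin 7) :
    HasProd (fun m : ℕ => (1 - C ((zeta ^ (k : ℕ)) ^ (m + 1)) * X ^ (m + 1) : ℂ⟦X⟧))
      (conjugate k (f 1)) := by
  convert (hasProd_toComplex_f le_rfl).map (rescale (zeta ^ (k : ℕ))) (continuous_rescale _)
    using 2 with m
  · simp [rescale_X, mul_pow]
  · rfl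

theorem hasProd_toComplex_f_seven_mul {r : ℕ} (hr : 1 ≤ r) :
    HasProd (fun m : ℕ => if 7 ∣ m + 1 then (1 - X ^ (r * (m + 1)) : ℂ⟦X⟧) else 1)
      (toComplex (f (7 * r))) := by
  have hinj : Function.Injective fun m : ℕ => 7 * m + 6 := fun a b h => by simpa using h
  rw [← hinj.hasProd_iff]
  · convert hasProd_toComplex_f (r := 7 * r) (by omega) using 2 with m
    rw [Function.comp_apply, if_pos ⟨m + 1, by ring⟩]
    ring
  · intro n hn
    refine if_neg ?_
    rintro ⟨l, hl⟩
    exact hn ⟨l - 1, show 7 * (l - 1) + 6 = n by omega⟩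

/-- Over all conjugates the m-th factor multiplies to 1 - q^(7m) if 7 ∤ m, and to (1 - q^m)^7 if 7 ∣
m. The second kind gives f_7^7, while the first kind completed by f_49 gives one more f_7. -/
theorem prod_conjugate_f_one :
    (∏ k, conjugate k (f 1)) * toComplex (f 49) = toComplex (f 7) ^ 8 := by
  have h1 := hasProd_prod (s := univ) fun k _ => hasProd_conjugate_f_one k
  simp only [prod_one_sub_zeta_pow_mul] at h1
  have h2 := h1.mul (hasProd_toComplex_f_seven_mul (r := 7) (by norm_num))
  have h3 := hasProd_prod (s := univ) fun (_ : Fin 7) _ =>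
    hasProd_toComplex_f_seven_mul (r := 1) le_rfl
  have h4 := (hasProd_toComplex_f (r := 7) (by norm_num)).mul h3
  simp only [prod_const, card_univ, Fintype.card_fin, mul_one] at h4
  rw [pow_succ' _ 7]
  refine h2.unique ?_
  convert h4 using 2 with m
  split_ifs with h
  · rw [one_mul]
    ring
  · rw [← pow_mul]
    ring

theorem constantCoeff_f_one : constantCoeff (f 1) = 1 := constantCoeff_f le_rfl

theorem f_one_ne_zero : f 1 ≠ 0 := fun h => by
  simpa [h] using constantCoeff_f_one

theorem f_ne_zero {r : ℕ} (hr : 1 ≤ r) : f r ≠ 0 := fun h => by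
  simpa [h] using constantCoeff_f hr

theorem shiftedF_ne_zero : shiftedF ≠ 0 :=
  mul_ne_zero (pow_ne_zero _ X_ne_zero) (f_ne_zero (by norm_num))

theorem hasResidue_part (r : ZMod 7) : HasResidue r (part r) := hasResidue_residuePart r _

theorem hasResidue_quarticPart : HasResidue (1 : ℕ) quarticPart := by
  have key {r s t : ZMod 7} {a b : ℤ⟦X⟧} (ha : HasResidue r a) (hb : HasResidue s b)
      (h : r + r + r + s = t) : HasResidue t (a * a * a * b) :=
    h ▸ ((ha.mul ha).mul ha).mul hb
  -- The zero series is inserted as a member of class 1, so that the leading minus sign becomes a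
  -- difference.
  have h := ((hasResidue_residuePart 1 0).sub (((key (hasResidue_part 0) (hasResidue_part 1)
    (t := 1) rfl).add (key (hasResidue_part 1) (hasResidue_part 5) rfl)).add
    (key (hasResidue_part 5) (hasResidue_part 0) rfl))).sub
    ((key hasResidue_shiftedF hasResidue_shiftedF (t := 1) rfl).const_mul 8)
  have h8 : (C 8 : ℤ⟦X⟧) = 8 := rfl
  have h0 : residuePart 1 0 = 0 := by ext; simp [residuePart]
  rw [h8, h0] at h
  convert h using 1
  · rfl
  · rw [quarticPart]
    ring

/-- The normalized conjugates of `f 1`. -/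
noncomputable def conjugateF (k : Fin 7) : ℂ⟦X⟧ := C (zeta ^ (k : ℕ)) ^ 5 * conjugate k (f 1)

theorem C_zeta_pow_seven (k : Fin 7) : (C (zeta ^ (k : ℕ)) : ℂ⟦X⟧) ^ 7 = 1 := by
  rw [← map_pow, ← pow_mul, mul_comm, pow_mul, isPrimitiveRoot_zeta.pow_eq_one, one_pow, map_one]

/-- E and V have classes 2 and 1. Replacing the conjugate of f 1 by ζ^(2k) times its normalization
gives every term of the equation the scalar ζ^(2k), up to seventh powers. Hence all seven normalized
conjugates are roots of one polynomial with unchanged coefficients. -/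
theorem conjugateF_root (k : Fin 7) :
    toComplex shiftedF * (conjugateF k ^ 7 + 7 * conjugateF k ^ 6 * toComplex shiftedF
      + 21 * conjugateF k ^ 5 * toComplex shiftedF ^ 2
      + 49 * conjugateF k ^ 4 * toComplex shiftedF ^ 3
      + 147 * conjugateF k ^ 3 * toComplex shiftedF ^ 4
      + 343 * conjugateF k ^ 2 * toComplex shiftedF ^ 5
      + 343 * conjugateF k * toComplex shiftedF ^ 6)
      + toComplex quarticPart * (7 * conjugateF k ^ 3 * toComplex shiftedF
        + 35 * conjugateF k ^ 2 * toComplex shiftedF ^ 2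
        + 49 * conjugateF k * toComplex shiftedF ^ 3) - toComplex quarticPart ^ 2 = 0 := by
  have h := congrArg (conjugate k) quarticPart_sq_eq
  have h7 := C_zeta_pow_seven k
  have hF : conjugate k (f 1) = C (zeta ^ (k : ℕ)) ^ 2 * conjugateF k := by
    rw [conjugateF]
    linear_combination (-conjugate k (f 1)) * h7
  simp only [map_sub, map_add, map_mul, map_pow, map_ofNat, map_zero] at h
  rw [hF, conjugate_of_hasResidue (r := 2) hasResidue_shiftedF,
    conjugate_of_hasResidue hasResidue_quarticPart] at h
  generalize C (zeta ^ (k : ℕ)) = c at *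
  generalize conjugateF k = F at *
  generalize toComplex shiftedF = E at *
  generalize toComplex quarticPart = V at *
  have h14 : c ^ 14 = 1 := by rw [show c ^ 14 = (c ^ 7) ^ 2 by ring, h7, one_pow]
  have h21 : c ^ 21 = 1 := by rw [show c ^ 21 = (c ^ 7) ^ 3 by ring, h7, one_pow]
  linear_combination c ^ 5 * h - E * (F ^ 7 + 7 * F ^ 6 * E + 21 * F ^ 5 * E ^ 2
    + 49 * F ^ 4 * E ^ 3 + 147 * F ^ 3 * E ^ 4 + 343 * F ^ 2 * E ^ 5 + 343 * F * E ^ 6) * h21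
    - V * (7 * F ^ 3 * E + 35 * F ^ 2 * E ^ 2 + 49 * F * E ^ 3) * h14 + V ^ 2 * h7

theorem zeta_pow_injective {j : ℕ} (hj : Nat.Coprime j 7) :
    Function.Injective fun k : Fin 7 => (zeta ^ (k : ℕ)) ^ j := fun k l hkl => by
  have h : (zeta ^ j) ^ (k : ℕ) = (zeta ^ j) ^ (l : ℕ) := by
    simp only [← pow_mul] at hkl ⊢
    rwa [mul_comm, mul_comm j]
  exact Fin.ext ((isPrimitiveRoot_zeta.pow_of_coprime j hj).pow_inj k.2 l.2 h)

theorem conjugateF_injective : Function.Injective conjugateF := fun k l hkl => by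
  have h := congrArg (coeff 0) hkl
  simp only [conjugateF, ← map_pow, coeff_C_mul, coeff_conjugate] at h
  rw [coeff_zero_eq_constantCoeff_apply, constantCoeff_f_one] at h
  exact zeta_pow_injective (j := 5) (by norm_num) (by simpa using h)

theorem prod_conjugateF : ∏ k, conjugateF k = ∏ k, conjugate k (f 1) := by
  simp only [conjugateF]
  rw [prod_mul_distrib, prod_pow, ← map_prod, prod_pow_eq_pow_sum]
  have : ∑ k : Fin 7, (k : ℕ) = 7 * 3 := by decide
  rw [this, pow_mul, isPrimitiveRoot_zeta.pow_eq_one]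
  simp

/-- As a polynomial in f 1 the equation has leading coefficient E and constant term -V^2. Vieta
gives V^2 = E ∏ F_k, and E carries the f_49 needed by `prod_conjugate_f_one`. -/
theorem quarticPart_sq : quarticPart ^ 2 = (X * f 7 ^ 4) ^ 2 := by
  apply toComplex_injective
  let a : ℕ → ℂ⟦X⟧ := fun i => match i with
    | 0 => -toComplex quarticPart ^ 2
    | 1 => 343 * toComplex shiftedF ^ 7 + 49 * toComplex quarticPart * toComplex shiftedF ^ 3
    | 2 => 343 * toComplex shiftedF ^ 6 + 35 * toComplex quarticPart * toComplex shiftedF ^ 2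
    | 3 => 147 * toComplex shiftedF ^ 5 + 7 * toComplex quarticPart * toComplex shiftedF
    | 4 => 49 * toComplex shiftedF ^ 4
    | 5 => 21 * toComplex shiftedF ^ 3
    | 6 => 7 * toComplex shiftedF ^ 2
    | _ => toComplex shiftedF
  have h := coeff_zero_eq_of_roots conjugateF_injective (a := a) fun k => by
    rw [← conjugateF_root k]
    simp only [sum_range_succ, range_zero, sum_empty, a]
    ring
  rw [prod_conjugateF] at h
  simp only [a] at h
  rw [map_pow, map_pow, map_mul, map_pow]
  have h1 := prod_conjugate_f_one
  have hE : toComplex shiftedF = toComplex X ^ 2 * toComplex (f 49) := by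
    rw [shiftedF, map_mul, map_pow]
  rw [hE] at h
  linear_combination (-1 : ℂ⟦X⟧) * h + toComplex X ^ 2 * h1

theorem coeff_one_f_one : coeff 1 (f 1) = -1 := by
  rw [f_one_eq_pentagonalSeries]
  have h := coeff_pentagonalSeries_pentagonal ℤ 1
  rw [show pentagonal 1 = 1 from rfl] at h
  rw [h]
  simp

/-- The coefficient of q decides the sign: A starts with 1 and B with -q, so -A^3 B contributes +q,
and no other term contributes. -/
theorem quarticPart_eq : quarticPart = X * f 7 ^ 4 := by
  rcases sq_eq_sq_iff_eq_or_eq_neg.mp quarticPart_sq with h | h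
  · exact h
  · have h1 := congrArg (coeff 1) h
    have c0 : constantCoeff (part 0) = 1 := by
      rw [← coeff_zero_eq_constantCoeff_apply, part, residuePart, coeff_mk]
      simp [constantCoeff_f_one]
    have c1 : constantCoeff (part 1) = 0 := by
      rw [← coeff_zero_eq_constantCoeff_apply]
      exact hasResidue_part 1 0 (by decide)
    have c5 : constantCoeff (part 5) = 0 := by
      rw [← coeff_zero_eq_constantCoeff_apply]
      exact hasResidue_part 5 0 (by decide)
    have d0 : coeff 1 (part 0) = 0 := hasResidue_part 0 1 (by decide)
    have d1 : coeff 1 (part 1) = -1 := by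
      rw [part, residuePart, coeff_mk, if_pos (by simp), coeff_one_f_one]
    have d5 : coeff 1 (part 5) = 0 := hasResidue_part 5 1 (by decide)
    have e0 : constantCoeff shiftedF = 0 := by simp [shiftedF]
    have f7 : constantCoeff (f 7) = 1 := constantCoeff_f (by norm_num)
    have h8 : (8 : ℤ⟦X⟧) = C 8 := rfl
    rw [quarticPart, h8] at h1
    simp [coeff_one_mul, pow_succ, c0, c1, c5, d0, d1, d5, e0, f7] at h1

/-! ### The operator extracting exponents divisible by 7, and the modular equation. -/

/-- The substitution `X ↦ X ^ 7`. -/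
noncomputable def expandSeven : ℤ⟦X⟧ →ₐ[ℤ] ℤ⟦X⟧ := expand 7 (by norm_num)

theorem coeff_expandSeven_mul (g : ℤ⟦X⟧) (n : ℕ) : coeff (7 * n) (expandSeven g) = coeff n g :=
  coeff_expand_mul _ _ _ _

theorem expandSeven_injective : Function.Injective expandSeven := fun g h hgh => by
  ext n
  rw [← coeff_expandSeven_mul, hgh, coeff_expandSeven_mul]

theorem hasResidue_expandSeven (g : ℤ⟦X⟧) : HasResidue 0 (expandSeven g) :=
  hasResidue_expand_seven dvd_rfl _ _

theorem expandSeven_f {r : ℕ} (hr : 1 ≤ r) : expandSeven (f r) = f (7 * r) := expand_f _ hr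

theorem expandSeven_X : expandSeven X = X ^ 7 := expand_X _ _

/-- The operator `∑ a n X ^ n ↦ ∑ a (7 n) X ^ n`. -/
noncomputable def huff (g : ℤ⟦X⟧) : ℤ⟦X⟧ := mk fun n => coeff (7 * n) g

theorem huff_add (g h : ℤ⟦X⟧) : huff (g + h) = huff g + huff h := by
  ext n
  simp [huff]

theorem huff_C_mul (c : ℤ) (g : ℤ⟦X⟧) : huff (C c * g) = C c * huff g := by
  ext n
  simp only [huff, coeff_mk, coeff_C_mul]

theorem huff_sum {ι : Type*} (s : Finset ι) (g : ι → ℤ⟦X⟧) :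
    huff (∑ i ∈ s, g i) = ∑ i ∈ s, huff (g i) := by
  ext n
  simp [huff]

theorem expandSeven_huff (g : ℤ⟦X⟧) : expandSeven (huff g) = residuePart 0 g := by
  ext n
  rw [expandSeven, coeff_expand, residuePart, coeff_mk, huff, coeff_mk]
  refine if_ctx_congr (ZMod.natCast_eq_zero_iff n 7).symm (fun h => ?_) fun _ => rfl
  rw [Nat.mul_div_cancel' ((ZMod.natCast_eq_zero_iff n 7).1 h)]

theorem residuePart_zero_mul {g : ℤ⟦X⟧} (hg : HasResidue 0 g) (h : ℤ⟦X⟧) :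
    residuePart 0 (g * h) = g * residuePart 0 h := by
  ext n
  by_cases hn : (n : ZMod 7) = 0
  · rw [residuePart, coeff_mk, if_pos hn, coeff_mul, coeff_mul]
    refine sum_congr rfl fun p hp => ?_
    rw [HasAntidiagonal.mem_antidiagonal] at hp
    by_cases h1 : (p.1 : ZMod 7) = 0
    · rw [residuePart, coeff_mk, if_pos]
      rw [← hp, Nat.cast_add, h1, zero_add] at hn
      exact hn
    · rw [hg _ h1, zero_mul, zero_mul]
  · rw [hasResidue_residuePart 0 _ n hn, hg.mul (hasResidue_residuePart 0 h) n (by simpa using hn)]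

theorem huff_expandSeven_mul (g h : ℤ⟦X⟧) : huff (expandSeven g * h) = g * huff h := by
  apply expandSeven_injective
  rw [map_mul, expandSeven_huff, expandSeven_huff,
    residuePart_zero_mul (hasResidue_expandSeven g)]

/-- The inverse of `f 1`. -/
noncomputable def invF : ℤ⟦X⟧ := invOfUnit (f 1) 1

theorem f_one_mul_invF : f 1 * invF = 1 := mul_invOfUnit _ _ (by simpa using constantCoeff_f_one)

/-- The series `q ^ 2 f_49 / f_1`. -/
noncomputable def ratio : ℤ⟦X⟧ := shiftedF * invF

theorem f_one_mul_ratio : f 1 * ratio = shiftedF := by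
  rw [ratio]
  linear_combination shiftedF * f_one_mul_invF

/-- The series `q (f_7 / f_1) ^ 4`. -/
noncomputable def hauptmodul : ℤ⟦X⟧ := X * quot ^ 4

theorem expandSeven_quot_mul : expandSeven quot * f 7 = f 49 := by
  have h := congrArg expandSeven f_one_mul_quot
  rw [map_mul, expandSeven_f le_rfl, expandSeven_f (by norm_num)] at h
  rw [mul_comm]
  exact h

theorem expandSeven_hauptmodul_mul :
    expandSeven hauptmodul * (X * f 7 ^ 4) = shiftedF ^ 4 := by
  rw [hauptmodul, map_mul, map_pow, expandSeven_X, shiftedF, ← expandSeven_quot_mul]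
  ring

/-- The modular equation of level seven. -/
theorem ratio_pow_seven : ratio ^ 7 =
    expandSeven hauptmodul * (7 * ratio ^ 4 + 35 * ratio ^ 5 + 49 * ratio ^ 6)
      + expandSeven hauptmodul ^ 2 * (1 + 7 * ratio + 21 * ratio ^ 2 + 49 * ratio ^ 3
        + 147 * ratio ^ 4 + 343 * ratio ^ 5 + 343 * ratio ^ 6) := by
  have h := quarticPart_sq_eq
  rw [quarticPart_eq] at h
  have hS := expandSeven_hauptmodul_mul
  have hE := shiftedF_ne_zero
  rw [← f_one_mul_ratio] at *
  have hF := f_one_ne_zero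
  generalize X * f 7 ^ 4 = W at *
  generalize f 1 = F at *
  generalize ratio = Z at *
  generalize expandSeven hauptmodul = S at *
  -- With E = F Z and S W = E^4, multiplying the equation for F by S^2 removes W and leaves the
  -- claim times F^7 E.
  refine mul_left_cancel₀ (mul_ne_zero (pow_ne_zero 7 hF) hE) ?_
  linear_combination (-S ^ 2) * h - (F ^ 4 * Z ^ 4 + S * W) * hS
    + (S * (7 * F ^ 4 * Z + 35 * F ^ 4 * Z ^ 2 + 49 * F ^ 4 * Z ^ 3)) * hS

/-! ### Power sums of the conjugates of Z, and the rows of the matrix. -/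

theorem conjugate_expandSeven (k : Fin 7) (g : ℤ⟦X⟧) :
    conjugate k (expandSeven g) = toComplex (expandSeven g) := by
  rw [conjugate_of_hasResidue (r := 0) (by simpa using hasResidue_expandSeven g), pow_zero, one_mul]

theorem conjugate_ratio_injective : Function.Injective fun k => conjugate k ratio := fun k l hkl => by
  have h := congrArg (coeff 2) hkl
  have h2 : coeff 2 ratio = 1 := by
    rw [ratio, shiftedF, mul_assoc, show 2 = 0 + 2 from rfl, coeff_X_pow_mul,
      coeff_zero_eq_constantCoeff_apply, map_mul, constantCoeff_f (by norm_num)]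
    simp [invF]
  simp only [coeff_conjugate, h2] at h
  exact zeta_pow_injective (j := 2) (by norm_num) (by simpa using h)

/-- The coefficients of the polynomial with the roots `conjugate k ratio`. -/
noncomputable def modularCoeff (S : ℂ⟦X⟧) : ℕ → ℂ⟦X⟧
  | 0 => -S ^ 2
  | 1 => -(7 * S ^ 2)
  | 2 => -(21 * S ^ 2)
  | 3 => -(49 * S ^ 2)
  | 4 => -(7 * S + 147 * S ^ 2)
  | 5 => -(35 * S + 343 * S ^ 2)
  | 6 => -(49 * S + 343 * S ^ 2)
  | _ => 1

theorem powerSum_conjugate_ratio {j : ℕ} (hj0 : 0 < j) (hj : j ≤ 7) :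
    ∑ k, conjugate k ratio ^ j =
      -(j * modularCoeff (toComplex (expandSeven hauptmodul)) (7 - j))
        - ∑ i ∈ Ico 1 j, modularCoeff (toComplex (expandSeven hauptmodul)) (7 - i) *
          ∑ k, conjugate k ratio ^ (j - i) := by
  refine powerSum_eq_of_roots conjugate_ratio_injective rfl (fun k => ?_) hj0 hj
  have h := congrArg (conjugate k) ratio_pow_seven
  simp only [map_add, map_mul, map_pow, map_ofNat, map_one, conjugate_expandSeven] at h
  simp only [sum_range_succ, range_zero, sum_empty, modularCoeff]
  linear_combination h

theorem huff_eq_of_powerSum {g h : ℤ⟦X⟧}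
    (H : ∑ k, conjugate k g = 7 * toComplex (expandSeven h)) : huff g = h := by
  apply expandSeven_injective
  apply toComplex_injective
  rw [sum_conjugate, ← expandSeven_huff] at H
  have h7 : (7 : ℂ⟦X⟧) ≠ 0 := fun h => by
    have h := congrArg constantCoeff h
    rw [map_ofNat] at h
    norm_num at h
  exact mul_left_cancel₀ h7 H

/-- The generating polynomial of a row of the matrix `m`, at `hauptmodul`. -/
noncomputable def rowSum (i N : ℕ) : ℤ⟦X⟧ := ∑ j ∈ range N, C (m i j) * hauptmodul ^ j

theorem m_zero_right (i : ℕ) : m i 0 = 0 := by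
  rcases lt_or_ge i 8 with hi | hi
  · interval_cases i <;> simp [m]
  · obtain ⟨n, rfl⟩ := Nat.exists_eq_add_of_le' hi
    simp [m]

theorem m_one_right {i : ℕ} (h : 4 ≤ i) : m i 1 = 0 := m_eq_zero i 1 (by omega)

theorem m_eq_zero_of_lt (i j : ℕ) (h : 2 * i < j) : m i j = 0 := by
  induction i using Nat.strong_induction_on generalizing j with
  | _ i ih =>
    rcases lt_or_ge i 8 with hi | hi
    · obtain ⟨j, rfl⟩ := Nat.exists_eq_add_of_lt h
      interval_cases i <;> simp [m, mRows, List.getElem?_eq_none]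
    · obtain ⟨n, rfl⟩ := Nat.exists_eq_add_of_le' hi
      obtain ⟨l, rfl⟩ := Nat.exists_eq_add_of_le' (show 3 ≤ j by omega)
      rw [m]
      rw [ih (n + 5) (by omega) (l + 2) (by omega), ih (n + 6) (by omega) (l + 2) (by omega),
        ih (n + 7) (by omega) (l + 2) (by omega), ih (n + 1) (by omega) (l + 1) (by omega),
        ih (n + 2) (by omega) (l + 1) (by omega), ih (n + 3) (by omega) (l + 1) (by omega),
        ih (n + 4) (by omega) (l + 1) (by omega), ih (n + 5) (by omega) (l + 1) (by omega),
        ih (n + 6) (by omega) (l + 1) (by omega), ih (n + 7) (by omega) (l + 1) (by omega)]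
      simp

/-- Row i has no entries beyond column 2i, so any longer truncation is the full row polynomial. -/
theorem rowSum_eq {i N M : ℕ} (hN : 2 * i < N) (hM : 2 * i < M) : rowSum i N = rowSum i M := by
  wlog h : N ≤ M generalizing N M
  · exact (this hM hN (by omega)).symm
  refine sum_subset (range_subset_range.2 h) fun j _ hj => ?_
  rw [m_eq_zero_of_lt i j (by simp at hj; omega), map_zero, zero_mul]

theorem rowSum_succ (i N : ℕ) :
    rowSum i (N + 1) = ∑ j ∈ range N, C (m i (j + 1)) * hauptmodul ^ (j + 1) := by
  rw [rowSum, sum_range_succ', m_zero_right, map_zero, zero_mul, add_zero]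

theorem rowSum_add_two {i : ℕ} (h : 4 ≤ i) (N : ℕ) :
    rowSum i (N + 2) = ∑ j ∈ range N, C (m i (j + 2)) * hauptmodul ^ (j + 2) := by
  rw [rowSum_succ, sum_range_succ', m_one_right h, map_zero, zero_mul, add_zero]

/-- The recurrence of m is multiplication by t and t^2. The truncations N+3, N+2, N+1 match these
shifts, and the vanishing of the first columns lets all sums start together. -/
theorem rowSum_recurrence (n N : ℕ) : rowSum (n + 8) (N + 3) =
    hauptmodul * (7 * rowSum (n + 5) (N + 2) + 35 * rowSum (n + 6) (N + 2)
      + 49 * rowSum (n + 7) (N + 2))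
    + hauptmodul ^ 2 * (rowSum (n + 1) (N + 1) + 7 * rowSum (n + 2) (N + 1)
      + 21 * rowSum (n + 3) (N + 1) + 49 * rowSum (n + 4) (N + 1) + 147 * rowSum (n + 5) (N + 1)
      + 343 * rowSum (n + 6) (N + 1) + 343 * rowSum (n + 7) (N + 1)) := by
  rw [rowSum_add_two (by omega), rowSum_add_two (by omega), rowSum_add_two (by omega),
    rowSum_add_two (by omega), sum_range_succ']
  simp only [rowSum_succ, mul_sum, ← sum_add_distrib]
  rw [show m (n + 8) (0 + 2) = 0 by simp [m], map_zero, zero_mul, add_zero]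
  refine sum_congr rfl fun l _ => ?_
  rw [m]
  simp only [map_add, map_mul, map_ofNat]
  ring

/-- The sum over conjugates is 7 times the part in class 0, so Newton's power sums divided by 7 are
the tabulated rows. -/
theorem huff_ratio_pow_of_le_seven {i : ℕ} (h0 : 0 < i) (h : i ≤ 7) :
    huff (ratio ^ i) = rowSum i (2 * i + 1) := by
  have p1 := powerSum_conjugate_ratio (j := 1) (by norm_num) (by norm_num)
  have p2 := powerSum_conjugate_ratio (j := 2) (by norm_num) (by norm_num)
  have p3 := powerSum_conjugate_ratio (j := 3) (by norm_num) (by norm_num)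
  have p4 := powerSum_conjugate_ratio (j := 4) (by norm_num) (by norm_num)
  have p5 := powerSum_conjugate_ratio (j := 5) (by norm_num) (by norm_num)
  have p6 := powerSum_conjugate_ratio (j := 6) (by norm_num) (by norm_num)
  have p7 := powerSum_conjugate_ratio (j := 7) (by norm_num) (by norm_num)
  simp only [sum_Ico_eq_sum_range, sum_range_succ, range_zero, sum_empty, modularCoeff,
    Nat.reduceAdd, Nat.reduceSub, Nat.cast_ofNat, Nat.cast_one] at p1 p2 p3 p4 p5 p6 p7
  refine huff_eq_of_powerSum ?_
  simp only [map_pow]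
  have hm : ∀ i N, toComplex (expandSeven (rowSum i N)) =
      ∑ j ∈ range N, (m i j : ℂ⟦X⟧) * toComplex (expandSeven hauptmodul) ^ j := fun i N => by
    simp [rowSum]
  rw [hm]
  generalize toComplex (expandSeven hauptmodul) = S at *
  have q1 : ∑ k, conjugate k ratio ^ 1 = 7 * (7 * S + 7 ^ 2 * S ^ 2) := by
    rw [p1]
    ring
  have q2 : ∑ k, conjugate k ratio ^ 2 = 7 * (10 * S + 9 * 7 ^ 2 * S ^ 2 + 2 * 7 ^ 4 * S ^ 3 + 7 ^
      5 * S ^ 4) := by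
    rw [p2, q1]
    ring
  have q3 : ∑ k, conjugate k ratio ^ 3 = 7 * (3 * S + 114 * 7 * S ^ 2 + 85 * 7 ^ 3 * S ^ 3 + 24 *
      7 ^ 5 * S ^ 4 + 3 * 7 ^ 7 * S ^ 5 + 7 ^ 8 * S ^ 6) := by
    rw [p3, q1, q2]
    ring
  have q4 : ∑ k, conjugate k ratio ^ 4 = 7 * (82 * 7 * S ^ 2 + 176 * 7 ^ 3 * S ^ 3 + 845 * 7 ^ 4 *
      S ^ 4 + 272 * 7 ^ 6 * S ^ 5 + 46 * 7 ^ 8 * S ^ 6 + 4 * 7 ^ 10 * S ^ 7 + 7 ^ 11 * S ^ 8) :=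
      by
    rw [p4, q1, q2, q3]
    ring
  have q5 : ∑ k, conjugate k ratio ^ 5 = 7 * (190 * S ^ 2 + 1265 * 7 ^ 2 * S ^ 3 + 1895 * 7 ^ 4 *
      S ^ 4 + 1233 * 7 ^ 6 * S ^ 5 + 3025 * 7 ^ 7 * S ^ 6 + 620 * 7 ^ 9 * S ^ 7 + 75 * 7 ^ 11 * S
      ^ 8 + 5 * 7 ^ 13 * S ^ 9 + 7 ^ 14 * S ^ 10) := by
    rw [p5, q1, q2, q3, q4]
    ring
  have q6 : ∑ k, conjugate k ratio ^ 6 = 7 * (27 * S ^ 2 + 736 * 7 ^ 2 * S ^ 3 + 16782 * 7 ^ 3 * S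
      ^ 4 + 20424 * 7 ^ 5 * S ^ 5 + 12825 * 7 ^ 7 * S ^ 6 + 4770 * 7 ^ 9 * S ^ 7 + 7830 * 7 ^ 10 *
      S ^ 8 + 1178 * 7 ^ 12 * S ^ 9 + 111 * 7 ^ 14 * S ^ 10 + 6 * 7 ^ 16 * S ^ 11 + 7 ^ 17 * S ^
      12) := by
    rw [p6, q1, q2, q3, q4, q5]
    ring
  have q7 : ∑ k, conjugate k ratio ^ 7 = 7 * (1 * S ^ 2 + 253 * 7 ^ 2 * S ^ 3 + 1902 * 7 ^ 4 * S ^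
      4 + 4246 * 7 ^ 6 * S ^ 5 + 31540 * 7 ^ 7 * S ^ 6 + 19302 * 7 ^ 9 * S ^ 7 + 7501 * 7 ^ 11 * S
      ^ 8 + 1944 * 7 ^ 13 * S ^ 9 + 2397 * 7 ^ 14 * S ^ 10 + 285 * 7 ^ 16 * S ^ 11 + 22 * 7 ^ 18 *
      S ^ 12 + 7 ^ 20 * S ^ 13 + 7 ^ 20 * S ^ 14) := by
    rw [p7, q1, q2, q3, q4, q5, q6]
    ring
  interval_cases i
  · rw [q1]
    congr 1
    simp [sum_range_succ, m, mRows]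
    norm_num
  · rw [q2]
    congr 1
    simp [sum_range_succ, m, mRows]
    ring
  · rw [q3]
    congr 1
    simp [sum_range_succ, m, mRows]
    ring
  · rw [q4]
    congr 1
    simp [sum_range_succ, m, mRows]
    ring
  · rw [q5]
    congr 1
    simp [sum_range_succ, m, mRows]
    ring
  · rw [q6]
    congr 1
    simp [sum_range_succ, m, mRows]
    ring
  · rw [q7]
    congr 1
    simp [sum_range_succ, m, mRows]
    ring

/-- Beyond row 7, multiply the modular equation by Z^(i-7). Series in q^7 pass through U, leaving
the recurrence of the row polynomials. -/
theorem huff_ratio_pow {i N : ℕ} (h0 : 0 < i) (hN : 2 * i < N) :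
    huff (ratio ^ i) = rowSum i N := by
  induction i using Nat.strong_induction_on generalizing N with
  | _ i ih =>
    rcases le_or_gt i 7 with hi | hi
    · rw [huff_ratio_pow_of_le_seven h0 hi]
      exact rowSum_eq (by omega) hN
    · obtain ⟨n, rfl⟩ := Nat.exists_eq_add_of_le' (show 8 ≤ i by omega)
      have hpow : ratio ^ (n + 8) =
          expandSeven hauptmodul * (C 7 * ratio ^ (n + 5) + C 35 * ratio ^ (n + 6)
            + C 49 * ratio ^ (n + 7))
          + expandSeven (hauptmodul ^ 2) * (ratio ^ (n + 1) + C 7 * ratio ^ (n + 2)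
            + C 21 * ratio ^ (n + 3) + C 49 * ratio ^ (n + 4) + C 147 * ratio ^ (n + 5)
            + C 343 * ratio ^ (n + 6) + C 343 * ratio ^ (n + 7)) := by
        rw [show ratio ^ (n + 8) = ratio ^ (n + 1) * ratio ^ 7 by ring, ratio_pow_seven]
        simp only [map_ofNat, map_pow]
        ring
      rw [rowSum_eq hN (show 2 * (n + 8) < 2 * n + 16 + 3 by omega), rowSum_recurrence, hpow]
      simp only [huff_add, huff_expandSeven_mul, huff_C_mul]
      rw [ih (n + 5) (by omega) (by omega) (N := 2 * n + 16 + 2) (by omega),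
        ih (n + 6) (by omega) (by omega) (N := 2 * n + 16 + 2) (by omega),
        ih (n + 7) (by omega) (by omega) (N := 2 * n + 16 + 2) (by omega),
        ih (n + 1) (by omega) (by omega) (N := 2 * n + 16 + 1) (by omega),
        ih (n + 2) (by omega) (by omega) (N := 2 * n + 16 + 1) (by omega),
        ih (n + 3) (by omega) (by omega) (N := 2 * n + 16 + 1) (by omega),
        ih (n + 4) (by omega) (by omega) (N := 2 * n + 16 + 1) (by omega),
        rowSum_eq (i := n + 5) (N := 2 * n + 16 + 2) (M := 2 * n + 16 + 1) (by omega) (by omega),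
        rowSum_eq (i := n + 6) (N := 2 * n + 16 + 2) (M := 2 * n + 16 + 1) (by omega) (by omega),
        rowSum_eq (i := n + 7) (N := 2 * n + 16 + 2) (M := 2 * n + 16 + 1) (by omega) (by omega)]
      simp only [map_ofNat]

/-! ### The generating function of b, and the action of U on q^r (f_7/f_1)^k. -/

/-- The generating function of the numbers of `ℓ`-regular partitions. -/
theorem mk_b_mul_f_one {ℓ : ℕ} (hℓ : 0 < ℓ) : (mk fun n => (b ℓ n : ℤ)) * f 1 = f ℓ := by
  have h1 : (mk fun n => (b ℓ n : ℤ)) =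
      mk fun n => ((Nat.Partition.countRestricted n ℓ).card : ℤ) := by
    ext n
    rw [coeff_mk, coeff_mk, b, Nat.Partition.card_restricted_eq_card_countRestricted n hℓ]
  rw [h1]
  have h2 := (Nat.Partition.hasProd_powerSeriesMk_card_countRestricted ℤ hℓ).mul
    (hasProd_f le_rfl)
  have hterm : ∀ i : ℕ, (∑ j ∈ range ℓ, (X : ℤ⟦X⟧) ^ ((i + 1) * j)) * (1 - X ^ (1 * (i + 1))) =
      1 - X ^ (ℓ * (i + 1)) := fun i => by
    simp only [pow_mul _ (i + 1), one_mul]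
    rw [geom_sum_mul_neg, ← pow_mul, mul_comm]
  simp only [hterm] at h2
  exact h2.unique (hasProd_f hℓ)

theorem mk_b_eq {ℓ : ℕ} (hℓ : 0 < ℓ) : (mk fun n => (b ℓ n : ℤ)) = f ℓ * invF := by
  linear_combination invF * mk_b_mul_f_one hℓ - (mk fun n => (b ℓ n : ℤ)) * f_one_mul_invF

theorem quot_eq : quot = f 7 * invF := rfl

theorem quot_ne_zero : quot ≠ 0 := fun h => by
  have := f_one_mul_quot
  rw [h, mul_zero] at this
  exact f_ne_zero (by norm_num) this.symm

theorem f_seven_mul_expandSeven_invF : f 7 * expandSeven invF = 1 := by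
  have := congrArg expandSeven f_one_mul_invF
  rwa [map_mul, expandSeven_f le_rfl, map_one] at this

theorem invF_eq : invF = expandSeven invF * quot := by
  rw [quot_eq]
  linear_combination (-invF) * f_seven_mul_expandSeven_invF

theorem ratio_eq : ratio = X ^ 2 * quot * expandSeven quot := by
  rw [ratio, shiftedF, ← expandSeven_quot_mul, quot_eq]
  ring

/-- Since 2k = 7s + r, Z^k is the value at q^7 of X^s quot^k, times X^r quot^k. The first factor
comes out of U. -/
theorem huff_X_pow_mul_quot_pow_mul {k r s N : ℕ} (hk : 0 < k) (h : 2 * k = 7 * s + r)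
    (hN : 2 * k < N) : huff (X ^ r * quot ^ k) * (X ^ s * quot ^ k) = rowSum k N := by
  rw [← huff_ratio_pow hk hN, ratio_eq]
  have : (X ^ 2 * quot * expandSeven quot) ^ k =
      expandSeven (X ^ s * quot ^ k) * (X ^ r * quot ^ k) := by
    rw [map_mul, map_pow, map_pow, expandSeven_X, mul_pow, mul_pow, ← pow_mul, ← pow_mul, h,
      pow_add]
    ring
  rw [this, huff_expandSeven_mul, mul_comm]

/-- The action of `huff` on the monomials `X ^ r * quot ^ k`. -/
theorem huff_X_pow_mul_quot_pow {k r s N : ℕ} (h : 2 * k = 7 * s + r) (hr : 0 < r)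
    (hks : k ≤ 4 * s + 4) (hN : 2 * k ≤ N) : huff (X ^ r * quot ^ k) =
      ∑ i ∈ Icc 1 N, C (m k (i + s)) * (X ^ i * quot ^ (4 * i + 4 * s - k)) := by
  have hne : (X : ℤ⟦X⟧) ^ s * quot ^ k ≠ 0 :=
    mul_ne_zero (pow_ne_zero _ X_ne_zero) (pow_ne_zero _ quot_ne_zero)
  refine mul_right_cancel₀ hne ?_
  rw [huff_X_pow_mul_quot_pow_mul (by omega) h (show 2 * k < N + s + 1 by omega), rowSum, sum_mul]
  symm
  refine sum_of_injOn (fun i => i + s) (fun a _ b _ h => by simpa using h) ?_ ?_ ?_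
  · intro i hi
    simp only [coe_Icc, Set.mem_Icc, coe_range, Set.mem_Iio] at hi ⊢
    omega
  · intro i hi hi'
    -- Columns up to s vanish, because 7s < 7s + r = 2k.
    rw [m_eq_zero, map_zero, zero_mul]
    by_contra hcon
    refine hi' ⟨i - s, ?_, ?_⟩
    · simp only [coe_Icc, Set.mem_Icc, mem_range] at hi ⊢
      omega
    · show i - s + s = i
      omega
  · intro i hi
    rw [mem_Icc] at hi
    rw [hauptmodul, mul_pow, ← pow_mul,
      show 4 * (i + s) = (4 * i + 4 * s - k) + k by omega]
    ring

/-! ### Progressions modulo 7 acting on coefficient vectors. -/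

/-- The operator `∑ a n X ^ n ↦ ∑ a (7 n + c) X ^ n`. -/
noncomputable def progression (c : ℕ) (g : ℤ⟦X⟧) : ℤ⟦X⟧ := mk fun n => coeff (7 * n + c) g

theorem X_mul_progression {c d : ℕ} (h : c + d = 7) (hd : 0 < d) (g : ℤ⟦X⟧) :
    X * progression c g = huff (X ^ d * g) := by
  ext n
  rw [huff, coeff_mk]
  cases n with
  | zero =>
    rw [mul_zero, coeff_zero_X_mul, coeff_X_pow_mul', if_neg (by omega)]
  | succ n =>
    rw [coeff_succ_X_mul, progression, coeff_mk, show 7 * (n + 1) = 7 * n + c + d by omega,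
      coeff_X_pow_mul]

/-- The finite linear combination `∑ v j X ^ (j - 1) quot ^ (4 j - e)`. -/
noncomputable def vecSeries (v : ℕ → ℤ) (N e : ℕ) : ℤ⟦X⟧ :=
  ∑ j ∈ Icc 1 N, C (v j) * (X ^ (j - 1) * quot ^ (4 * j - e))

theorem X_mul_vecSeries (v : ℕ → ℤ) (N e : ℕ) :
    X * vecSeries v N e = ∑ j ∈ Icc 1 N, C (v j) * (X ^ j * quot ^ (4 * j - e)) := by
  rw [vecSeries, mul_sum]
  refine sum_congr rfl fun j hj => ?_
  rw [mem_Icc] at hj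
  obtain ⟨j, rfl⟩ := Nat.exists_eq_add_of_le' hj.1
  rw [Nat.add_sub_cancel]
  ring

/-- The common form of the transformations of the coefficient vectors. -/
theorem huff_sum_eq_X_mul_vecSeries {v w : ℕ → ℤ} {N M e : ℕ} {r k s : ℕ → ℕ}
    (h : ∀ i, 1 ≤ i → 2 * k i = 7 * s i + r i ∧ 0 < r i ∧ 4 * s i + 4 = k i + (4 - e) ∧
      2 * k i ≤ M * i) (he : e ≤ 4)
    (hw : ∀ j, 1 ≤ j → w j = ∑ i ∈ Icc 1 N, v i * m (k i) (j + s i)) :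
    huff (∑ i ∈ Icc 1 N, C (v i) * (X ^ r i * quot ^ k i)) = X * vecSeries w (M * N) e := by
  rw [X_mul_vecSeries, huff_sum]
  have h1 : ∀ i ∈ Icc 1 N, huff (C (v i) * (X ^ r i * quot ^ k i)) = ∑ j ∈ Icc 1 (M * N),
      C (v i * m (k i) (j + s i)) * (X ^ j * quot ^ (4 * j - e)) := fun i hi => by
    rw [mem_Icc] at hi
    obtain ⟨h1, h2, h3, h4⟩ := h i hi.1
    rw [huff_C_mul, huff_X_pow_mul_quot_pow h1 h2 (by omega)
      (h4.trans (Nat.mul_le_mul_left _ hi.2)), mul_sum]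
    refine sum_congr rfl fun j _ => ?_
    rw [map_mul, show 4 * j + 4 * s i - k i = 4 * j - e by omega]
    ring
  rw [sum_congr rfl h1, sum_comm]
  refine sum_congr rfl fun j hj => ?_
  rw [mem_Icc] at hj
  rw [hw j hj.1, map_sum, sum_mul]

theorem progression_expandSeven_mul {c d : ℕ} (h : c + d = 7) (hd : 0 < d) (g u : ℤ⟦X⟧) :
    progression c (expandSeven g * u) = g * progression c u := by
  refine mul_left_cancel₀ X_ne_zero ?_
  rw [X_mul_progression h hd, mul_left_comm X g, X_mul_progression h hd, mul_left_comm,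
    huff_expandSeven_mul]

theorem progression_vecSeries_four_mul_sub_one {v w : ℕ → ℤ} {N : ℕ}
    (hw : ∀ j, 1 ≤ j → w j = ∑ i ∈ Icc 1 N, v i * m (4 * i - 1) (i + j - 1)) :
    progression 1 (vecSeries v N 1) = vecSeries w (10 * N) 3 := by
  refine mul_left_cancel₀ X_ne_zero ?_
  rw [X_mul_progression (d := 6) rfl (by norm_num), vecSeries, mul_sum,
    ← huff_sum_eq_X_mul_vecSeries (v := v) (r := fun i => i + 5) (k := fun i => 4 * i - 1)
      (s := fun i => i - 1) (fun i hi => by omega) (by norm_num)]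
  · congr 1
    refine sum_congr rfl fun i hi => ?_
    rw [mem_Icc] at hi
    rw [show i + 5 = 6 + (i - 1) by omega, pow_add]
    ring
  · intro j hj
    rw [hw j hj]
    refine sum_congr rfl fun i hi => ?_
    rw [mem_Icc] at hi
    rw [show i + j - 1 = j + (i - 1) by omega]

theorem progression_vecSeries_four_mul_sub_three {v w : ℕ → ℤ} {N : ℕ}
    (hw : ∀ j, 1 ≤ j → w j = ∑ i ∈ Icc 1 N, v i * m (4 * i - 3) (i + j - 1)) :
    progression 5 (vecSeries v N 3) = vecSeries w (10 * N) 1 := by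
  refine mul_left_cancel₀ X_ne_zero ?_
  rw [X_mul_progression (d := 2) rfl (by norm_num), vecSeries, mul_sum,
    ← huff_sum_eq_X_mul_vecSeries (v := v) (r := fun i => i + 1) (k := fun i => 4 * i - 3)
      (s := fun i => i - 1) (fun i hi => by omega) (by norm_num)]
  · congr 1
    refine sum_congr rfl fun i hi => ?_
    rw [mem_Icc] at hi
    rw [show i + 1 = 2 + (i - 1) by omega, pow_add]
    ring
  · intro j hj
    rw [hw j hj]
    refine sum_congr rfl fun i hi => ?_
    rw [mem_Icc] at hi
    rw [show i + j - 1 = j + (i - 1) by omega]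

theorem progression_vecSeries_four_mul {v w : ℕ → ℤ} {N : ℕ}
    (hw : ∀ j, 1 ≤ j → w j = ∑ i ∈ Icc 1 N, v i * m (4 * i) (i + j)) :
    progression 6 (vecSeries v N 0) = vecSeries w (10 * N) 0 := by
  refine mul_left_cancel₀ X_ne_zero ?_
  rw [X_mul_progression (d := 1) rfl (by norm_num), vecSeries, mul_sum,
    ← huff_sum_eq_X_mul_vecSeries (v := v) (r := fun i => i) (k := fun i => 4 * i)
      (s := fun i => i) (fun i hi => by omega) (by norm_num)]
  · congr 1
    refine sum_congr rfl fun i hi => ?_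
    rw [mem_Icc] at hi
    rw [show X ^ i = X ^ (1 + (i - 1)) by rw [show 1 + (i - 1) = i by omega], pow_add]
    simp only [Nat.sub_zero]
    ring
  · intro j hj
    rw [hw j hj]
    exact sum_congr rfl fun i hi => by rw [add_comm i j]

theorem quot_mul_vecSeries (v : ℕ → ℤ) (N : ℕ) :
    quot * vecSeries v N 1 = vecSeries v N 0 := by
  rw [vecSeries, vecSeries, mul_sum]
  refine sum_congr rfl fun j hj => ?_
  rw [mem_Icc] at hj
  rw [show 4 * j - 0 = 4 * j - 1 + 1 by omega]
  ring

/-- Writing 1/f_1 = (1/f_7) quot raises the exponents to 4j+1. Extraction turns 1/f_7 into 1/f_1 and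
leaves exponents 4j-1, and a second use of the same identity restores 4j. -/
theorem progression_invF_mul_vecSeries {v w : ℕ → ℤ} {N : ℕ}
    (hw : ∀ j, 1 ≤ j → w j = ∑ i ∈ Icc 1 N, v i * m (4 * i + 1) (i + j)) :
    progression 4 (invF * vecSeries v N 0) = expandSeven invF * vecSeries w (10 * N) 0 := by
  have h : progression 4 (quot * vecSeries v N 0) = vecSeries w (10 * N) 1 := by
    refine mul_left_cancel₀ X_ne_zero ?_
    rw [X_mul_progression (d := 3) rfl (by norm_num), vecSeries, mul_sum, mul_sum,
      ← huff_sum_eq_X_mul_vecSeries (v := v) (r := fun i => i + 2) (k := fun i => 4 * i + 1)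
        (s := fun i => i) (fun i hi => by omega) (by norm_num)]
    · congr 1
      refine sum_congr rfl fun i hi => ?_
      rw [mem_Icc] at hi
      rw [show i + 2 = 3 + (i - 1) by omega, pow_add]
      simp only [Nat.sub_zero]
      ring
    · intro j hj
      rw [hw j hj]
      exact sum_congr rfl fun i hi => by rw [add_comm i j]
  rw [invF_eq, mul_assoc, progression_expandSeven_mul (d := 3) rfl (by norm_num), h,
    ← quot_mul_vecSeries w, ← mul_assoc, ← invF_eq, ← invF_eq]

theorem progression_invF : progression 5 invF = expandSeven invF * vecSeries (x 1) 2 0 := by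
  have h : progression 5 quot = vecSeries (x 1) 2 1 := by
    refine mul_left_cancel₀ X_ne_zero ?_
    rw [X_mul_progression (d := 2) rfl (by norm_num), ← pow_one quot,
      huff_X_pow_mul_quot_pow (s := 0) (N := 2) rfl (by norm_num) (by norm_num) (by norm_num),
      X_mul_vecSeries]
    refine sum_congr rfl fun i hi => ?_
    rw [mem_Icc] at hi
    congr 2
    obtain ⟨h1, h2⟩ := hi
    interval_cases i <;> simp [x, m, mRows]
  rw [invF_eq, progression_expandSeven_mul (d := 2) rfl (by norm_num), h,
    ← quot_mul_vecSeries (x 1), ← mul_assoc, ← invF_eq, ← invF_eq]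

/-! ### The vectors x and y as finite sums, and the inductions along the progressions. -/

theorem finsum_eq_sum_Icc {v u : ℕ → ℤ} {N : ℕ} (hv : ∀ j, N < j → v j = 0) :
    ∑ᶠ (j : ℕ) (_ : 1 ≤ j), v j * u j = ∑ j ∈ Icc 1 N, v j * u j := by
  refine finsum_cond_eq_sum_of_cond_iff _ fun {j} hj => ?_
  rw [mem_Icc]
  refine ⟨fun h => ⟨h, ?_⟩, fun h => h.1⟩
  by_contra hN
  exact hj (by rw [hv j (by omega), zero_mul])

/-- Each step multiplies the support bound by at most 10: row k i ends at column 2 (k i), and the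
largest row used, 4i+1, has 8i+2 ≤ 10i. -/
theorem sum_mul_m_eq_zero {v : ℕ → ℤ} {N j : ℕ} {k s : ℕ → ℕ}
    (h : ∀ i, 1 ≤ i → 2 * k i ≤ 10 * i) (hs : ∀ i, 1 ≤ i → j ≤ s i) (hj : 10 * N < j) :
    ∑ i ∈ Icc 1 N, v i * m (k i) (s i) = 0 := by
  refine sum_eq_zero fun i hi => ?_
  rw [mem_Icc] at hi
  rw [m_eq_zero_of_lt, mul_zero]
  have h1 := h i hi.1
  have h2 := hs i hi.1
  omega

theorem x_succ_of_odd {s N : ℕ} (hs : Odd s) (hv : ∀ j, N < j → x s j = 0) (j : ℕ) :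
    x (s + 1) j = ∑ i ∈ Icc 1 N, x s i * m (4 * i) (i + j) := by
  obtain ⟨s, rfl⟩ := Nat.exists_eq_add_one.2 hs.pos
  simp only [x, if_pos hs]
  exact finsum_eq_sum_Icc hv

theorem x_succ_of_even {s N : ℕ} (h0 : 0 < s) (hs : ¬Odd s) (hv : ∀ j, N < j → x s j = 0)
    (j : ℕ) : x (s + 1) j = ∑ i ∈ Icc 1 N, x s i * m (4 * i + 1) (i + j) := by
  obtain ⟨s, rfl⟩ := Nat.exists_eq_add_one.2 h0
  simp only [x, if_neg hs]
  exact finsum_eq_sum_Icc hv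

theorem y_succ_of_odd {k β N : ℕ} (hβ : Odd β) (hv : ∀ j, N < j → y k β j = 0) (j : ℕ) :
    y k (β + 1) j = ∑ i ∈ Icc 1 N, y k β i * m (4 * i - 1) (i + j - 1) := by
  obtain ⟨β, rfl⟩ := Nat.exists_eq_add_one.2 hβ.pos
  simp only [y, if_pos hβ]
  exact finsum_eq_sum_Icc hv

theorem y_succ_of_even {k β N : ℕ} (h0 : 0 < β) (hβ : ¬Odd β) (hv : ∀ j, N < j → y k β j = 0)
    (j : ℕ) : y k (β + 1) j = ∑ i ∈ Icc 1 N, y k β i * m (4 * i - 3) (i + j - 1) := by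
  obtain ⟨β, rfl⟩ := Nat.exists_eq_add_one.2 h0
  simp only [y, if_neg hβ]
  exact finsum_eq_sum_Icc hv

theorem progression_mk (a : ℕ → ℤ) (c d e e' : ℕ) (he : e' = 7 * e) :
    progression c (mk fun n => a (e * n + d)) = mk fun n => a (e' * n + (e * c + d)) := by
  ext n
  rw [progression, coeff_mk, coeff_mk, coeff_mk, he]
  congr 1
  ring

/-- The generating function along the first arithmetic progressions. -/
theorem mk_b_eq_x {k s : ℕ} (hs0 : 1 ≤ s) (hs : s ≤ 2 * k - 1) : ∃ N : ℕ,
    (∀ j, N < j → x s j = 0) ∧ ∀ δ, 24 * δ = (if Odd s then 17 else 23) * 7 ^ s + 1 →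
      (mk fun n => (b (7 ^ (2 * k - 1)) (7 ^ s * n + δ) : ℤ)) = f (7 ^ (2 * k - 1 - s)) *
        ((if Odd s then expandSeven invF else invF) * vecSeries (x s) N 0) := by
  -- While s < 2k-1 the numerator is a series in q^7, so it passes through the extraction and loses
  -- one factor 7 in its index.
  have hexp : ∀ s, s + 1 ≤ 2 * k - 1 →
      f (7 ^ (2 * k - 1 - s)) = expandSeven (f (7 ^ (2 * k - 1 - (s + 1)))) := fun s hs => by
    rw [expandSeven_f (Nat.one_le_pow _ _ (by norm_num)), ← pow_succ',
      show 2 * k - 1 - (s + 1) + 1 = 2 * k - 1 - s by omega]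
  induction s, hs0 using Nat.le_induction with
  | base =>
    refine ⟨2, fun j hj => ?_, fun δ hδ => ?_⟩
    · simp only [x]
      rw [if_neg (by omega), if_neg (by omega)]
    · obtain rfl : δ = 5 := by simp at hδ; omega
      have h := progression_mk (fun n => (b (7 ^ (2 * k - 1)) n : ℤ)) 5 0 1 7 rfl
      simp only [one_mul, add_zero] at h
      rw [pow_one, ← h, mk_b_eq (by positivity), if_pos odd_one]
      have h0 := hexp 0 hs
      rw [Nat.sub_zero] at h0
      rw [h0, progression_expandSeven_mul (d := 2) rfl (by norm_num), progression_invF]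
  | succ s hs0 ih =>
    obtain ⟨N, hN, hG⟩ := ih (by omega)
    rw [hexp s hs] at hG
    by_cases hodd : Odd s
    · have hodd' : ¬Odd (s + 1) := by grind
      refine ⟨10 * N, fun j hj => ?_, fun δ hδ => ?_⟩
      · rw [x_succ_of_odd hodd hN]
        exact sum_mul_m_eq_zero (fun i hi => by omega) (fun i hi => by omega) hj
      · rw [if_neg hodd', pow_succ] at hδ
        -- Residue 6 fits since 17 + 24·6 = 7·23; the even case uses residue 4 since 23 + 24·4 =
        -- 7·17.
        have hG := hG (δ - 7 ^ s * 6) (by rw [if_pos hodd]; omega)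
        have h := progression_mk (fun n => (b (7 ^ (2 * k - 1)) n : ℤ)) 6 (δ - 7 ^ s * 6) (7 ^ s)
          (7 ^ (s + 1)) (pow_succ' _ _)
        rw [show 7 ^ s * 6 + (δ - 7 ^ s * 6) = δ by omega] at h
        rw [← h, hG, if_pos hodd, if_neg hodd', progression_expandSeven_mul (d := 1) rfl (by norm_num),
          progression_expandSeven_mul (d := 1) rfl (by norm_num),
          progression_vecSeries_four_mul fun j _ => x_succ_of_odd hodd hN j]
    · have hodd' : Odd (s + 1) := by grind
      refine ⟨10 * N, fun j hj => ?_, fun δ hδ => ?_⟩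
      · rw [x_succ_of_even hs0 hodd hN]
        exact sum_mul_m_eq_zero (fun i hi => by omega) (fun i hi => by omega) hj
      · rw [if_pos hodd', pow_succ] at hδ
        have hG := hG (δ - 7 ^ s * 4) (by rw [if_neg hodd]; omega)
        have h := progression_mk (fun n => (b (7 ^ (2 * k - 1)) n : ℤ)) 4 (δ - 7 ^ s * 4) (7 ^ s)
          (7 ^ (s + 1)) (pow_succ' _ _)
        rw [show 7 ^ s * 4 + (δ - 7 ^ s * 4) = δ by omega] at h
        rw [← h, hG, if_neg hodd, if_pos hodd', progression_expandSeven_mul (d := 3) rfl (by norm_num),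
          progression_invF_mul_vecSeries fun j _ => x_succ_of_even hs0 hodd hN j]

/-- The generating function along the later arithmetic progressions. -/
theorem mk_b_eq_y {k : ℕ} (hk : 1 ≤ k) (β : ℕ) : ∃ N : ℕ,
    (∀ j, N < j → y k (β + 1) j = 0) ∧
    ∀ δ, 24 * δ + 7 ^ (2 * k - 1) = (if Even β then 18 else 6) * 7 ^ (2 * k - 1 + β) + 1 →
      (mk fun n => (b (7 ^ (2 * k - 1)) (7 ^ (2 * k - 1 + β) * n + δ) : ℤ)) =
        vecSeries (y k (β + 1)) N (if Even β then 1 else 3) := by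
  induction β with
  | zero =>
    obtain ⟨N, hN, hG⟩ := mk_b_eq_x (k := k) (s := 2 * k - 1) (by omega) le_rfl
    have hodd : Odd (2 * k - 1) := ⟨k - 1, by omega⟩
    refine ⟨N, hN, fun δ hδ => ?_⟩
    have hy : y k (0 + 1) = x (2 * k - 1) := rfl
    rw [hy, if_pos Even.zero, add_zero]
    rw [if_pos Even.zero, add_zero] at hδ
    rw [hG δ (by rw [if_pos hodd]; omega), if_pos hodd, Nat.sub_self, pow_zero,
      ← quot_mul_vecSeries]
    -- At s = 2k-1 the prefactor is f_1/f_7, which cancels one power of f_7/f_1 and lowers the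
    -- exponents from 4j to 4j-1.
    linear_combination expandSeven invF * vecSeries (x (2 * k - 1)) N 1 * f_one_mul_quot
      + vecSeries (x (2 * k - 1)) N 1 * f_seven_mul_expandSeven_invF
  | succ β ih =>
    obtain ⟨N, hN, hG⟩ := ih
    by_cases heven : Even β
    · have heven' : ¬Even (β + 1) := by grind
      have hodd : Odd (β + 1) := by grind
      refine ⟨10 * N, fun j hj => ?_, fun δ hδ => ?_⟩
      · rw [y_succ_of_odd hodd hN]
        exact sum_mul_m_eq_zero (fun i hi => by omega) (fun i hi => by omega) hj
      · have hle : 7 ^ (2 * k - 1) ≤ 7 ^ (2 * k - 1 + β) :=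
          Nat.pow_le_pow_right (by norm_num) (by omega)
        rw [if_neg heven', ← add_assoc, pow_succ] at hδ
        -- Residue 1 fits since 18 + 24·1 = 7·6; the other parity uses residue 5 since 6 + 24·5 =
        -- 7·18.
        have hG := hG (δ - 7 ^ (2 * k - 1 + β) * 1) (by rw [if_pos heven]; omega)
        have h := progression_mk (fun n => (b (7 ^ (2 * k - 1)) n : ℤ)) 1
          (δ - 7 ^ (2 * k - 1 + β) * 1) (7 ^ (2 * k - 1 + β)) (7 ^ (2 * k - 1 + (β + 1)))
          (pow_succ' _ _)
        rw [show 7 ^ (2 * k - 1 + β) * 1 + (δ - 7 ^ (2 * k - 1 + β) * 1) = δ by omega] at h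
        rw [← h, hG, if_pos heven, if_neg heven',
          progression_vecSeries_four_mul_sub_one fun j _ => y_succ_of_odd hodd hN j]
    · have heven' : Even (β + 1) := by grind
      have hodd : ¬Odd (β + 1) := by grind
      refine ⟨10 * N, fun j hj => ?_, fun δ hδ => ?_⟩
      · rw [y_succ_of_even (by omega) hodd hN]
        exact sum_mul_m_eq_zero (fun i hi => by omega) (fun i hi => by omega) hj
      · have hle : 7 ^ (2 * k - 1) ≤ 7 ^ (2 * k - 1 + β) :=
          Nat.pow_le_pow_right (by norm_num) (by omega)
        rw [if_pos heven', ← add_assoc, pow_succ] at hδ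
        have hG := hG (δ - 7 ^ (2 * k - 1 + β) * 5) (by rw [if_neg heven]; omega)
        have h := progression_mk (fun n => (b (7 ^ (2 * k - 1)) n : ℤ)) 5
          (δ - 7 ^ (2 * k - 1 + β) * 5) (7 ^ (2 * k - 1 + β)) (7 ^ (2 * k - 1 + (β + 1)))
          (pow_succ' _ _)
        rw [show 7 ^ (2 * k - 1 + β) * 5 + (δ - 7 ^ (2 * k - 1 + β) * 5) = δ by omega] at h
        rw [← h, hG, if_neg heven, if_pos heven',
          progression_vecSeries_four_mul_sub_three fun j _ => y_succ_of_even (by omega) hodd hN j]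

theorem hasSum_vecSeries {v : ℕ → ℤ} {N : ℕ} (hv : ∀ j, N < j → v j = 0) (e : ℕ) :
    HasSum (fun j : ℕ+ => C (v j) * X ^ ((j : ℕ) - 1) * quot ^ (4 * (j : ℕ) - e))
      (vecSeries v N e) := by
  have h : HasSum (fun j : ℕ => if 1 ≤ j then C (v j) * X ^ (j - 1) * quot ^ (4 * j - e) else 0)
      (∑ j ∈ Icc 1 N, if 1 ≤ j then C (v j) * X ^ (j - 1) * quot ^ (4 * j - e) else 0) := by
    refine hasSum_sum_of_ne_finset_zero fun j hj => ?_
    rw [mem_Icc, not_and] at hj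
    split_ifs with h1
    · rw [hv j (by have := hj h1; omega), map_zero, zero_mul, zero_mul]
    · rfl
  rw [← PNat.coe_injective.hasSum_iff] at h
  · convert h using 1
    · ext1 j
      rw [Function.comp_apply, if_pos (Nat.succ_le_of_lt j.pos)]
    · refine sum_congr rfl fun j hj => ?_
      rw [mem_Icc] at hj
      rw [if_pos hj.1, mul_assoc]
  · intro j hj
    refine if_neg fun h1 => hj ⟨⟨j, h1⟩, rfl⟩

theorem pow_mod_twentyFour (k : ℕ) (hk : 1 ≤ k) : 7 ^ (2 * k - 1) % 24 = 7 := by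
  obtain ⟨k, rfl⟩ := Nat.exists_eq_add_of_le' hk
  rw [show 2 * (k + 1) - 1 = 2 * k + 1 by omega, pow_succ, pow_mul, Nat.mul_mod, Nat.pow_mod]
  norm_num

end SevenRegular

theorem theorem2 (β k : ℕ) (hk : 1 ≤ k) :
    HasSum
      (fun j : ℕ+ => PowerSeries.C (SevenRegular.y k (2 * β + 1) j) *
        PowerSeries.X ^ ((j : ℕ) - 1) * SevenRegular.quot ^ (4 * (j : ℕ) - 1))
      (PowerSeries.mk fun n : ℕ =>
        (SevenRegular.b (7 ^ (2 * k - 1))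
          (7 ^ (2 * k + 2 * β - 1) * n +
            (18 * 7 ^ (2 * k + 2 * β - 1) - 7 ^ (2 * k - 1) + 1) / 24) : ℤ)) ∧
    HasSum
      (fun j : ℕ+ => PowerSeries.C (SevenRegular.y k (2 * β + 2) j) *
        PowerSeries.X ^ ((j : ℕ) - 1) * SevenRegular.quot ^ (4 * (j : ℕ) - 3))
      (PowerSeries.mk fun n : ℕ =>
        (SevenRegular.b (7 ^ (2 * k - 1))
          (7 ^ (2 * k + 2 * β) * n +
            (6 * 7 ^ (2 * k + 2 * β) - 7 ^ (2 * k - 1) + 1) / 24) : ℤ)) := by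
  have hmod := SevenRegular.pow_mod_twentyFour k hk
  have hmod1 := SevenRegular.pow_mod_twentyFour (k + β) (by omega)
  have hle : 7 ^ (2 * k - 1) ≤ 7 ^ (2 * (k + β) - 1) :=
    Nat.pow_le_pow_right (by norm_num) (by omega)
  have hsucc : 7 ^ (2 * k + 2 * β) = 7 * 7 ^ (2 * (k + β) - 1) := by
    rw [← pow_succ']
    congr 1
    omega
  have hE : Even (2 * β) := even_two_mul β
  have hO : ¬Even (2 * β + 1) := by grind
  constructor
  · obtain ⟨N, hN, hG⟩ := SevenRegular.mk_b_eq_y hk (2 * β)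
    simp only [if_pos hE, show 2 * k - 1 + 2 * β = 2 * (k + β) - 1 by omega] at hG
    -- Odd powers of 7 are 7 modulo 24, and 18·7 - 7 + 1 = 120, so the division by 24 is exact;
    -- `hle` keeps the natural subtraction from truncating.
    rw [show 2 * k + 2 * β - 1 = 2 * (k + β) - 1 by omega, hG _ (by omega)]
    exact SevenRegular.hasSum_vecSeries hN 1
  · obtain ⟨N, hN, hG⟩ := SevenRegular.mk_b_eq_y hk (2 * β + 1)
    simp only [if_neg hO, show 2 * k - 1 + (2 * β + 1) = 2 * k + 2 * β by omega] at hG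
    rw [hG _ (by omega)]
    exact SevenRegular.hasSum_vecSeries hN 3
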